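/- Let $X$ be a compact Hausdorff space and $A$ a unital $C^*$-algebra. A (right) Hilbert $A$-module is finitely generated projective if it is isomorphic to an orthogonal direct summand of $A^n$ for some $n$; a finitely generated projective Hilbert $A$-module bundle over $X$ is a topological space $E\to X$ whose fibers are finitely generated projective Hilbert $A$-modules and which is locally isomorphic to products $U\times V$ ($U\subset X$ open, $V$ a Hilbert $A$-module) through homeomorphisms that are fiberwise (inner product preserving) isomorphisms of Hilbert $A$-modules. Let $K(X;A)$ be the Grothendieck group of the monoid, under direct sum, of isomorphism classes of finitely generated projective Hilbert $A$-module bundles over $X$, and let $K_0(C(X,A))$ be the Grothendieck group of the isomorphism classes of finitely generated projective right modules over the $C^*$-algebra $C(X,A)$ of continuous functions $X\to A$. Then for every finitely generated projective Hilbert $A$-module bundle $E$ the right $C(X,A)$-module $C(X,E)$ of continuous sections of $E$ is finitely generated and projective, and there is an isomorphism of groups $$K(X;A)\;\xrightarrow{\ \cong\ }\;K_0(C(X,A)),\qquad [E]\mapsto [C(X,E)].$$ Moreover $C(X,A)\cong C(X)\otimes A$, where $\otimes$ is the minimal $C^*$-algebra tensor product, and this is the only $C^*$-tensor product of $C(X)$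 and $A$: there is a $*$-homomorphism $\iota\colon C(X)\otimes_{\mathrm{alg}}A\to C(X,A)$ with $\iota(f\otimes a)(x)=f(x)a$; it is injective with dense range; $\|\iota(t)\|$ is the minimal $C^*$-norm of $t$ for every $t\in C(X)\otimes_{\mathrm{alg}}A$; and for every injective unital $*$-homomorphism $j$ from $C(X)\otimes_{\mathrm{alg}}A$ to a unital $C^*$-algebra one has $\|j(t)\|=\|\iota(t)\|$ for all $t$. -/

import Mathlib

open scoped TensorProduct ENNReal
open MulOpposite

universe u v w

noncomputable section

set_option linter.unusedSectionVars false

/-! ### Right Hilbert modules over a unital C⋆-algebra -/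

/-- A (right) Hilbert `A`-module: a right `A`-module (i.e. a module over `Aᵐᵒᵖ`) with an `A`-valued
inner product, `A`-linear in the second variable, which is a Banach space for the norm
`‖⟪v, v⟫‖ ^ (1/2)`.  (Mathlib's `CStarModule` treats left modules.) -/
class HilbertModule (A : Type*) [CStarAlgebra A] [PartialOrder A] (V : Type*)
    [NormedAddCommGroup V] [Module Aᵐᵒᵖ V] extends Inner A V where
  inner_op_smul_right (v w : V) (a : A) : inner v (op a • w) = inner v w * a
  inner_add_left (v₁ v₂ v₃ : V) : inner (v₁ + v₂) v₃ = inner v₁ v₃ + inner v₂ v₃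
  star_inner (v w : V) : star (inner v w) = inner w v
  inner_self_nonneg (v : V) : 0 ≤ inner v v
  inner_self_eq_zero (v : V) : inner v v = 0 ↔ v = 0
  norm_eq_sqrt (v : V) : ‖v‖ = √‖inner v v‖
  complete : CompleteSpace V

/-- An isomorphism of Hilbert `A`-modules: an `A`-linear bijection preserving the inner products. -/
structure HilbertModuleIso (A : Type*) [CStarAlgebra A] [PartialOrder A] (V W : Type*)
    [NormedAddCommGroup V] [Module Aᵐᵒᵖ V] [HilbertModule A V]
    [NormedAddCommGroup W] [Module Aᵐᵒᵖ W] [HilbertModule A W] extends V ≃ₗ[Aᵐᵒᵖ] W where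
  inner_map (v w : V) : inner A (toLinearEquiv v) (toLinearEquiv w) = inner A v w

/-- A Hilbert `A`-module is finitely generated projective if, for some `n`, it is isomorphic as a
Hilbert `A`-module to an orthogonal direct summand of `A ^ n`, where `A ^ n` carries the inner
product `∑ k, star (a k) * b k`: there is an `A`-linear map `i : V → A ^ n` preserving the inner
products such that every `y : A ^ n` is the sum of an element of the range of `i` and an
element orthogonal to the range of `i`. -/
def HilbertModule.IsFGP (A : Type*) [CStarAlgebra A] [PartialOrder A] (V : Type*)
    [NormedAddCommGroup V] [Module Aᵐᵒᵖ V] [HilbertModule A V] : Prop :=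
  ∃ (n : ℕ) (i : V →ₗ[Aᵐᵒᵖ] (Fin n → A)),
    (∀ v w, ∑ k, star (i v k) * i w k = inner A v w) ∧
    ∀ y : Fin n → A, ∃ v, ∀ w, ∑ k, star (i w k) * (y k - i v k) = 0

namespace HilbertModuleIso

variable {A : Type*} [CStarAlgebra A] [PartialOrder A] {V W Z : Type*}
  [NormedAddCommGroup V] [Module Aᵐᵒᵖ V] [HilbertModule A V]
  [NormedAddCommGroup W] [Module Aᵐᵒᵖ W] [HilbertModule A W]
  [NormedAddCommGroup Z] [Module Aᵐᵒᵖ Z] [HilbertModule A Z]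

def refl (A : Type*) [CStarAlgebra A] [PartialOrder A] (V : Type*)
    [NormedAddCommGroup V] [Module Aᵐᵒᵖ V] [HilbertModule A V] : HilbertModuleIso A V V where
  toLinearEquiv := LinearEquiv.refl _ _
  inner_map _ _ := rfl

def symm (φ : HilbertModuleIso A V W) : HilbertModuleIso A W V where
  toLinearEquiv := φ.toLinearEquiv.symm
  inner_map v w := by
    rw [← φ.inner_map, LinearEquiv.apply_symm_apply, LinearEquiv.apply_symm_apply]

def trans (φ : HilbertModuleIso A V W) (ψ : HilbertModuleIso A W Z) : HilbertModuleIso A V Z where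
  toLinearEquiv := φ.toLinearEquiv.trans ψ.toLinearEquiv
  inner_map v w := by
    rw [← φ.inner_map, ← ψ.inner_map]; rfl

end HilbertModuleIso

namespace HilbertModule

variable {A : Type*} [CStarAlgebra A] [PartialOrder A]

section Basic

variable {V : Type*} [NormedAddCommGroup V] [Module Aᵐᵒᵖ V] [HilbertModule A V]

theorem inner_add_right (v₁ v₂ v₃ : V) :
    inner A v₁ (v₂ + v₃) = inner A v₁ v₂ + inner A v₁ v₃ := by
  rw [← star_inner (A := A) (v₂ + v₃) v₁, inner_add_left, star_add, star_inner, star_inner]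

theorem inner_op_smul_left (v w : V) (a : A) :
    inner A (op a • v) w = star a * inner A v w := by
  rw [← star_inner (A := A) w, inner_op_smul_right, star_mul, star_inner]

theorem norm_op_smul_le (a : Aᵐᵒᵖ) (v : V) : ‖a • v‖ ≤ ‖a‖ * ‖v‖ := by
  rw [norm_eq_sqrt (A := A), norm_eq_sqrt (A := A) v]
  obtain ⟨a, rfl⟩ := op_surjective a
  rw [inner_op_smul_right, inner_op_smul_left, MulOpposite.norm_op]
  refine (Real.sqrt_le_left (by positivity)).2 ?_
  rw [mul_pow, Real.sq_sqrt (norm_nonneg _)]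
  calc ‖star a * inner A v v * a‖ ≤ ‖star a‖ * ‖inner A v v‖ * ‖a‖ :=
        (norm_mul_le _ _).trans (by gcongr; exact norm_mul_le _ _)
    _ = ‖a‖ ^ 2 * ‖inner A v v‖ := by rw [norm_star]; ring

variable (A V) in
theorem continuousSMul : ContinuousSMul Aᵐᵒᵖ V :=
  haveI : IsBoundedSMul Aᵐᵒᵖ V := .of_norm_smul_le norm_op_smul_le
  inferInstance

end Basic

/-- The zero module is a Hilbert `A`-module. -/
instance : HilbertModule A PUnit where
  inner _ _ := 0
  inner_op_smul_right _ _ _ := by simp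
  inner_add_left _ _ _ := by simp
  star_inner _ _ := by simp
  inner_self_nonneg _ := le_rfl
  inner_self_eq_zero _ := by simp
  norm_eq_sqrt _ := by simp
  complete := inferInstance

theorem isFGP_punit : IsFGP A PUnit :=
  ⟨0, 0, fun _ _ => by simp; rfl, fun _ => ⟨0, fun _ => by simp⟩⟩

end HilbertModule

/-! ### Direct sums of Hilbert modules -/

/-- The direct sum of two Hilbert `A`-modules, with inner product
`⟪(v₁, w₁), (v₂, w₂)⟫ = ⟪v₁, v₂⟫ + ⟪w₁, w₂⟫` and the corresponding norm. -/
@[nolint unusedArguments]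
def HilbertSum (_A : Type*) (V W : Type*) : Type _ := V × W

namespace HilbertSum

variable {A : Type*} [CStarAlgebra A] [PartialOrder A] [StarOrderedRing A] {V W : Type*}
  [NormedAddCommGroup V] [Module Aᵐᵒᵖ V] [HilbertModule A V]
  [NormedAddCommGroup W] [Module Aᵐᵒᵖ W] [HilbertModule A W]

instance : AddCommGroup (HilbertSum A V W) := inferInstanceAs (AddCommGroup (V × W))
instance : Module Aᵐᵒᵖ (HilbertSum A V W) := inferInstanceAs (Module Aᵐᵒᵖ (V × W))
instance : Inner A (HilbertSum A V W) := ⟨fun p q => inner A p.1 q.1 + inner A p.2 q.2⟩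

instance : Norm (HilbertSum A V W) := ⟨fun p => √‖inner A p p‖⟩

theorem inner_def (p q : HilbertSum A V W) : inner A p q = inner A p.1 q.1 + inner A p.2 q.2 := rfl

theorem inner_self_eq_zero (p : HilbertSum A V W) : inner A p p = 0 ↔ p = 0 := by
  rw [inner_def, add_eq_zero_iff_of_nonneg (HilbertModule.inner_self_nonneg _)
    (HilbertModule.inner_self_nonneg _), HilbertModule.inner_self_eq_zero,
    HilbertModule.inner_self_eq_zero]
  exact (Prod.ext_iff (x := p) (y := (0 : V × W))).symm

theorem exists_normCore : ∃ _ : Module ℂ (HilbertSum A V W), NormedSpace.Core ℂ (HilbertSum A V W) := by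
  let : Module ℂ (HilbertSum A V W) := Module.compHom _ (algebraMap ℂ Aᵐᵒᵖ)
  let : CStarModule Aᵐᵒᵖ (HilbertSum A V W) :=
    { inner := fun p q => op (inner A p q)
      inner_add_right := fun {p q r} => by
        rw [← op_add]
        refine congrArg op ?_
        simp only [inner_def]
        rw [show (q + r).1 = q.1 + r.1 from rfl, show (q + r).2 = q.2 + r.2 from rfl,
          HilbertModule.inner_add_right, HilbertModule.inner_add_right]
        abel
      inner_self_nonneg := fun {p} => by
        show (0 : A) ≤ inner A p p
        exact add_nonneg (HilbertModule.inner_self_nonneg _) (HilbertModule.inner_self_nonneg _)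
      inner_self := fun {p} => by rw [op_eq_zero_iff, inner_self_eq_zero]
      inner_op_smul_right := fun {a p q} => by
        obtain ⟨a, rfl⟩ := op_surjective a
        rw [← op_mul]
        refine congrArg op ?_
        simp only [inner_def]
        rw [show (op a • q).1 = op a • q.1 from rfl, show (op a • q).2 = op a • q.2 from rfl,
          HilbertModule.inner_op_smul_right, HilbertModule.inner_op_smul_right, add_mul]
      inner_smul_right_complex := fun {z p q} => by
        rw [← op_smul]
        refine congrArg op ?_
        simp only [inner_def]
        rw [show (z • q).1 = op (algebraMap ℂ A z) • q.1 from rfl,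
          show (z • q).2 = op (algebraMap ℂ A z) • q.2 from rfl,
          HilbertModule.inner_op_smul_right, HilbertModule.inner_op_smul_right, ← add_mul,
          ← Algebra.commutes, ← Algebra.smul_def]
      star_inner := fun p q => by
        rw [← op_star, inner_def, inner_def, star_add, HilbertModule.star_inner,
          HilbertModule.star_inner]
      norm_eq_sqrt_norm_inner_self := fun p => rfl }
  exact ⟨inferInstance, CStarModule.normedSpaceCore Aᵐᵒᵖ⟩

instance : NormedAddCommGroup (HilbertSum A V W) :=
  letI := (exists_normCore (A := A) (V := V) (W := W)).choose
  NormedAddCommGroup.ofCore (exists_normCore (A := A) (V := V) (W := W)).choose_spec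

theorem norm_def (p : HilbertSum A V W) : ‖p‖ = √‖inner A p p‖ := rfl

theorem norm_fst_le (p : HilbertSum A V W) : ‖p.1‖ ≤ ‖p‖ := by
  rw [norm_def, HilbertModule.norm_eq_sqrt (A := A) p.1, inner_def]
  refine Real.sqrt_le_sqrt (CStarAlgebra.norm_le_norm_of_nonneg_of_le
    (HilbertModule.inner_self_nonneg _) ?_)
  exact le_add_of_nonneg_right (HilbertModule.inner_self_nonneg _)

theorem norm_snd_le (p : HilbertSum A V W) : ‖p.2‖ ≤ ‖p‖ := by
  rw [norm_def, HilbertModule.norm_eq_sqrt (A := A) p.2, inner_def]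
  refine Real.sqrt_le_sqrt (CStarAlgebra.norm_le_norm_of_nonneg_of_le
    (HilbertModule.inner_self_nonneg _) ?_)
  exact le_add_of_nonneg_left (HilbertModule.inner_self_nonneg _)

theorem norm_le (p : HilbertSum A V W) : ‖p‖ ≤ ‖p.1‖ + ‖p.2‖ := by
  rw [norm_def, HilbertModule.norm_eq_sqrt (A := A) p.1, HilbertModule.norm_eq_sqrt (A := A) p.2,
    inner_def]
  refine (Real.sqrt_le_left (by positivity)).2 ((norm_add_le _ _).trans ?_)
  nlinarith [Real.sq_sqrt (norm_nonneg (inner A p.1 p.1)),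
    Real.sq_sqrt (norm_nonneg (inner A p.2 p.2)), Real.sqrt_nonneg ‖inner A p.1 p.1‖,
    Real.sqrt_nonneg ‖inner A p.2 p.2‖]

/-- The projections and the inclusion of pairs, as additive maps. -/
def fstHom : HilbertSum A V W →+ V := ⟨⟨fun p => p.1, rfl⟩, fun _ _ => rfl⟩

def sndHom : HilbertSum A V W →+ W := ⟨⟨fun p => p.2, rfl⟩, fun _ _ => rfl⟩

def mkHom : V × W →+ HilbertSum A V W := ⟨⟨fun p => p, rfl⟩, fun _ _ => rfl⟩

theorem continuous_fst : Continuous (fun p : HilbertSum A V W => p.1) :=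
  AddMonoidHomClass.continuous_of_bound (fstHom (A := A) (V := V) (W := W)) 1
    fun p => by rw [one_mul]; exact norm_fst_le p

theorem continuous_snd : Continuous (fun p : HilbertSum A V W => p.2) :=
  AddMonoidHomClass.continuous_of_bound (sndHom (A := A) (V := V) (W := W)) 1
    fun p => by rw [one_mul]; exact norm_snd_le p

theorem continuous_mk : Continuous (mkHom (A := A) (V := V) (W := W)) := by
  refine AddMonoidHomClass.continuous_of_bound (mkHom (A := A) (V := V) (W := W))
    2 fun p => ?_
  refine (norm_le (mkHom (A := A) p)).trans ?_
  have h1 : ‖p.1‖ ≤ ‖p‖ := _root_.norm_fst_le p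
  have h2 : ‖p.2‖ ≤ ‖p‖ := _root_.norm_snd_le p
  have h : ‖(mkHom (A := A) p).1‖ + ‖(mkHom (A := A) p).2‖ = ‖p.1‖ + ‖p.2‖ := rfl
  linarith

instance : HilbertModule A (HilbertSum A V W) where
  inner_op_smul_right p q a := by
    simp only [inner_def]
    rw [show (op a • q).1 = op a • q.1 from rfl, show (op a • q).2 = op a • q.2 from rfl,
      HilbertModule.inner_op_smul_right, HilbertModule.inner_op_smul_right, add_mul]
  inner_add_left p q r := by
    simp only [inner_def]
    rw [show (p + q).1 = p.1 + q.1 from rfl, show (p + q).2 = p.2 + q.2 from rfl,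
      HilbertModule.inner_add_left, HilbertModule.inner_add_left]
    abel
  star_inner p q := by
    rw [inner_def, inner_def, star_add, HilbertModule.star_inner, HilbertModule.star_inner]
  inner_self_nonneg p :=
    add_nonneg (HilbertModule.inner_self_nonneg _) (HilbertModule.inner_self_nonneg _)
  inner_self_eq_zero := inner_self_eq_zero
  norm_eq_sqrt := norm_def
  complete := by
    have := HilbertModule.complete (A := A) (V := V)
    have := HilbertModule.complete (A := A) (V := W)
    refine Metric.complete_of_cauchySeq_tendsto fun u hu => ?_
    have h1 : CauchySeq fun n => (u n).1 := by
      refine (LipschitzWith.uniformContinuous (K := 1) ?_).comp_cauchySeq hu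
        (f := fun p : HilbertSum A V W => p.1)
      exact LipschitzWith.of_dist_le_mul fun p q => by
        rw [dist_eq_norm, dist_eq_norm, NNReal.coe_one, one_mul]; exact norm_fst_le (p - q)
    have h2 : CauchySeq fun n => (u n).2 := by
      refine (LipschitzWith.uniformContinuous (K := 1) ?_).comp_cauchySeq hu
        (f := fun p : HilbertSum A V W => p.2)
      exact LipschitzWith.of_dist_le_mul fun p q => by
        rw [dist_eq_norm, dist_eq_norm, NNReal.coe_one, one_mul]; exact norm_snd_le (p - q)
    obtain ⟨a, ha⟩ := cauchySeq_tendsto_of_complete h1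
    obtain ⟨b, hb⟩ := cauchySeq_tendsto_of_complete h2
    exact ⟨mkHom (a, b), (continuous_mk.tendsto (a, b)).comp (ha.prodMk_nhds hb)⟩

/-- The direct sum of two isomorphisms of Hilbert modules. -/
def congr {V' W' : Type*} [NormedAddCommGroup V'] [Module Aᵐᵒᵖ V'] [HilbertModule A V']
    [NormedAddCommGroup W'] [Module Aᵐᵒᵖ W'] [HilbertModule A W']
    (φ : HilbertModuleIso A V V') (ψ : HilbertModuleIso A W W') :
    HilbertModuleIso A (HilbertSum A V W) (HilbertSum A V' W') where
  toLinearEquiv := LinearEquiv.prodCongr φ.toLinearEquiv ψ.toLinearEquiv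
  inner_map p q := congrArg₂ (· + ·) (φ.inner_map p.1 q.1) (ψ.inner_map p.2 q.2)

variable (A V W) in
def comm : HilbertModuleIso A (HilbertSum A V W) (HilbertSum A W V) where
  toLinearEquiv := LinearEquiv.prodComm Aᵐᵒᵖ V W
  inner_map p q := add_comm (inner A p.2 q.2) (inner A p.1 q.1)

variable (A V W) in
def assoc (Z : Type*) [NormedAddCommGroup Z] [Module Aᵐᵒᵖ Z] [HilbertModule A Z] :
    HilbertModuleIso A (HilbertSum A (HilbertSum A V W) Z) (HilbertSum A V (HilbertSum A W Z)) where
  toLinearEquiv := LinearEquiv.prodAssoc Aᵐᵒᵖ V W Z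
  inner_map p q :=
    (add_assoc (inner A p.1.1 q.1.1) (inner A p.1.2 q.1.2) (inner A p.2 q.2)).symm

variable (A V) in
def zeroSum : HilbertModuleIso A (HilbertSum A PUnit.{w + 1} V) V where
  toLinearEquiv := LinearEquiv.uniqueProd (R := Aᵐᵒᵖ) (M := V) (M₂ := PUnit.{w + 1})
  inner_map p q := (zero_add (inner A p.2 q.2)).symm

theorem isFGP (hV : HilbertModule.IsFGP A V) (hW : HilbertModule.IsFGP A W) :
    HilbertModule.IsFGP A (HilbertSum A V W) := by
  obtain ⟨n, i, hi, hi'⟩ := hV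
  obtain ⟨m, j, hj, hj'⟩ := hW
  refine ⟨n + m,
    { toFun := fun p => Fin.append (i p.1) (j p.2)
      map_add' := fun p q => ?_
      map_smul' := fun a p => ?_ }, fun p q => ?_, fun y => ?_⟩
  · ext k
    refine Fin.addCases (fun k => ?_) (fun k => ?_) k
    · simp [show (p + q).1 = p.1 + q.1 from rfl]
    · simp [show (p + q).2 = p.2 + q.2 from rfl]
  · ext k
    refine Fin.addCases (fun k => ?_) (fun k => ?_) k
    · simp [show (a • p).1 = a • p.1 from rfl]
    · simp [show (a • p).2 = a • p.2 from rfl]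
  · simp [Fin.sum_univ_add, inner_def, hi, hj]
  · obtain ⟨v, hv⟩ := hi' fun k => y (Fin.castAdd m k)
    obtain ⟨w, hw⟩ := hj' fun k => y (Fin.natAdd n k)
    refine ⟨mkHom (v, w), fun p => ?_⟩
    have h1 : (mkHom (A := A) (v, w)).1 = v := rfl
    have h2 : (mkHom (A := A) (v, w)).2 = w := rfl
    simp [Fin.sum_univ_add, h1, h2, hv, hw]

end HilbertSum

/-! ### Hilbert module bundles -/

/-- The total space (disjoint union of the fibers) of a family of types, without topology. -/
@[ext]
structure FamilyTotal {X : Type*} (E : X → Type*) where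
  base : X
  vec : E base

/-- A fiberwise isomorphism `φ` of the restriction to `U` of a family `E` of Hilbert modules with
the constant family `V` is a local trivialization if the map
`E|_U → U × V` it defines is a homeomorphism. -/
structure IsLocalTrivialization {A : Type*} [CStarAlgebra A] [PartialOrder A] {X : Type*}
    [TopologicalSpace X] {E : X → Type*} [∀ x, NormedAddCommGroup (E x)]
    [∀ x, Module Aᵐᵒᵖ (E x)] [∀ x, HilbertModule A (E x)] [TopologicalSpace (FamilyTotal E)]
    {U : Set X} {V : Type*} [NormedAddCommGroup V] [Module Aᵐᵒᵖ V] [HilbertModule A V]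
    (φ : ∀ x : U, HilbertModuleIso A (E x) V) : Prop where
  continuous_toFun : Continuous fun p : {p : FamilyTotal E // p.base ∈ U} =>
    ((⟨p.1.base, p.2⟩, (φ ⟨p.1.base, p.2⟩).toLinearEquiv p.1.vec) : U × V)
  continuous_invFun : Continuous fun q : U × V =>
    (⟨⟨q.1, (φ q.1).toLinearEquiv.symm q.2⟩, q.1.2⟩ : {p : FamilyTotal E // p.base ∈ U})

/-- A Hilbert `A`-module bundle over `X`: a family of Hilbert `A`-modules with a topology on its
total space, which is locally trivial through fiberwise isomorphisms of Hilbert `A`-modules.  The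
typical fiber is allowed to vary. -/
structure HilbertBundle (A : Type v) [CStarAlgebra A] [PartialOrder A] (X : Type u)
    [TopologicalSpace X] where
  Fiber : X → Type (max u v)
  [fiberNormed : ∀ x, NormedAddCommGroup (Fiber x)]
  [fiberModule : ∀ x, Module Aᵐᵒᵖ (Fiber x)]
  [fiberHilbert : ∀ x, HilbertModule A (Fiber x)]
  [topTotal : TopologicalSpace (FamilyTotal Fiber)]
  continuous_base : Continuous fun p : FamilyTotal Fiber => p.base
  exists_trivialization : ∀ x₀ : X, ∃ U : Set X, IsOpen U ∧ x₀ ∈ U ∧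
    ∃ (V : Type (max u v)) (_ : NormedAddCommGroup V) (_ : Module Aᵐᵒᵖ V) (_ : HilbertModule A V)
      (φ : ∀ x : U, HilbertModuleIso A (Fiber x) V), IsLocalTrivialization φ

attribute [instance] HilbertBundle.fiberNormed HilbertBundle.fiberModule
  HilbertBundle.fiberHilbert HilbertBundle.topTotal

namespace HilbertBundle

variable {A : Type v} [CStarAlgebra A] [PartialOrder A] {X : Type u} [TopologicalSpace X]

/-- The total space of a bundle. -/
abbrev Total (E : HilbertBundle A X) : Type (max u v) := FamilyTotal E.Fiber

/-- The map of total spaces defined by a family of isomorphisms between the fibers. -/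
def totalMap {E F : HilbertBundle A X} (φ : ∀ x, HilbertModuleIso A (E.Fiber x) (F.Fiber x)) :
    E.Total → F.Total :=
  fun p => ⟨p.base, (φ p.base).toLinearEquiv p.vec⟩

/-- Two bundles are isomorphic if there is a homeomorphism between the total spaces which restricts
on each fiber to an isomorphism of Hilbert modules. -/
def IsIso (E F : HilbertBundle A X) : Prop :=
  ∃ φ : ∀ x, HilbertModuleIso A (E.Fiber x) (F.Fiber x),
    Continuous (totalMap φ) ∧ Continuous (totalMap fun x => (φ x).symm)

theorem IsIso.refl (E : HilbertBundle A X) : IsIso E E :=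
  ⟨fun x => .refl A (E.Fiber x), continuous_id, continuous_id⟩

theorem IsIso.symm {E F : HilbertBundle A X} : IsIso E F → IsIso F E :=
  fun ⟨φ, h, h'⟩ => ⟨fun x => (φ x).symm, h', h⟩

theorem IsIso.trans {E F G : HilbertBundle A X} : IsIso E F → IsIso F G → IsIso E G :=
  fun ⟨φ, h, h'⟩ ⟨ψ, k, k'⟩ => ⟨fun x => (φ x).trans (ψ x), k.comp h, h'.comp k'⟩

/-- The bundle with zero fibers. -/
def zero (A : Type v) [CStarAlgebra A] [PartialOrder A] (X : Type u) [TopologicalSpace X] :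
    HilbertBundle A X :=
  letI : TopologicalSpace (FamilyTotal fun _ : X => PUnit.{max u v + 1}) :=
    .induced (fun p => p.base) inferInstance
  { Fiber := fun _ => PUnit
    continuous_base := continuous_induced_dom
    exists_trivialization := fun x₀ => ⟨Set.univ, isOpen_univ, trivial, PUnit, inferInstance,
      inferInstance, inferInstance, fun _ => .refl A PUnit,
      { continuous_toFun := by
          refine Continuous.prodMk ?_ (continuous_const (y := PUnit.unit))
          exact (Continuous.comp (g := fun p : FamilyTotal fun _ : X => PUnit.{max u v + 1} =>
            p.base) continuous_induced_dom continuous_subtype_val).subtype_mk _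
        continuous_invFun := by
          refine Continuous.subtype_mk (continuous_induced_rng.2 ?_) _
          exact continuous_subtype_val.comp continuous_fst }⟩ }

section Sum

variable [StarOrderedRing A]

/-- The total space of the direct sum has the topology of the fiber product of the total spaces. -/
abbrev sumTopology (E F : HilbertBundle A X) :
    TopologicalSpace (FamilyTotal fun x => HilbertSum A (E.Fiber x) (F.Fiber x)) :=
  .induced (fun p => ((⟨p.base, p.vec.1⟩, ⟨p.base, p.vec.2⟩) : E.Total × F.Total)) inferInstance

/-- The direct sum (Whitney sum) of two bundles. -/
def sum (E F : HilbertBundle A X) : HilbertBundle A X :=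
  letI := sumTopology E F
  { Fiber := fun x => HilbertSum A (E.Fiber x) (F.Fiber x)
    continuous_base := by
      have hd : Continuous (fun p : FamilyTotal fun x => HilbertSum A (E.Fiber x) (F.Fiber x) =>
          ((⟨p.base, p.vec.1⟩, ⟨p.base, p.vec.2⟩) : E.Total × F.Total)) :=
        continuous_induced_dom
      exact E.continuous_base.comp (continuous_fst.comp hd)
    exists_trivialization := fun x₀ => by
      obtain ⟨U, hU, hx, V, _, _, _, φ, hφ⟩ := E.exists_trivialization x₀
      obtain ⟨U', hU', hx', V', _, _, _, φ', hφ'⟩ := F.exists_trivialization x₀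
      have hl : Continuous fun q : (U ∩ U' : Set X) × HilbertSum A V V' =>
          ((⟨q.1, q.1.2.1⟩, q.2.1) : U × V) :=
        ((continuous_subtype_val.comp continuous_fst).subtype_mk _).prodMk
          (HilbertSum.continuous_fst.comp continuous_snd)
      have hr : Continuous fun q : (U ∩ U' : Set X) × HilbertSum A V V' =>
          ((⟨q.1, q.1.2.2⟩, q.2.2) : U' × V') :=
        ((continuous_subtype_val.comp continuous_fst).subtype_mk _).prodMk
          (HilbertSum.continuous_snd.comp continuous_snd)
      have hd : Continuous (fun p : FamilyTotal fun x => HilbertSum A (E.Fiber x) (F.Fiber x) =>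
          ((⟨p.base, p.vec.1⟩, ⟨p.base, p.vec.2⟩) : E.Total × F.Total)) :=
        continuous_induced_dom
      refine ⟨U ∩ U', hU.inter hU', ⟨hx, hx'⟩, HilbertSum A V V', inferInstance, inferInstance,
        inferInstance, fun x => HilbertSum.congr (φ ⟨x, x.2.1⟩) (φ' ⟨x, x.2.2⟩), ?_, ?_⟩
      · refine Continuous.prodMk ?_ ?_
        · exact (E.continuous_base.comp
            (continuous_fst.comp (hd.comp continuous_subtype_val))).subtype_mk _
        · have h1 := continuous_snd.comp (hφ.continuous_toFun.comp
            ((continuous_fst.comp (hd.comp continuous_subtype_val)).subtype_mk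
              fun (p : {p : FamilyTotal fun x => HilbertSum A (E.Fiber x) (F.Fiber x) //
                p.base ∈ U ∩ U'}) => p.2.1))
          have h2 := continuous_snd.comp (hφ'.continuous_toFun.comp
            ((continuous_snd.comp (hd.comp continuous_subtype_val)).subtype_mk
              fun (p : {p : FamilyTotal fun x => HilbertSum A (E.Fiber x) (F.Fiber x) //
                p.base ∈ U ∩ U'}) => p.2.2))
          exact HilbertSum.continuous_mk.comp (h1.prodMk h2)
      · refine Continuous.subtype_mk ?_ _
        have h1 := continuous_subtype_val.comp (hφ.continuous_invFun.comp hl)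
        have h2 := continuous_subtype_val.comp (hφ'.continuous_invFun.comp hr)
        exact continuous_induced_rng.2 (h1.prodMk h2) }

variable {E F G E' F' : HilbertBundle A X}

/-- The two components of a point of the total space of the direct sum. -/
def sumFst (p : (sum E F).Total) : E.Total := ⟨p.base, HilbertSum.fstHom (A := A) p.vec⟩

def sumSnd (p : (sum E F).Total) : F.Total := ⟨p.base, HilbertSum.sndHom (A := A) p.vec⟩

theorem isInducing_sum :
    Topology.IsInducing fun p : (sum E F).Total => (sumFst p, sumSnd p) := ⟨rfl⟩

theorem continuous_sum_fst : Continuous (sumFst (E := E) (F := F)) :=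
  continuous_fst.comp isInducing_sum.continuous

theorem continuous_sum_snd : Continuous (sumSnd (E := E) (F := F)) :=
  continuous_snd.comp isInducing_sum.continuous

theorem continuous_sum_rng {T : Type*} [TopologicalSpace T] {f : T → (sum E F).Total}
    (h₁ : Continuous fun t => sumFst (f t)) (h₂ : Continuous fun t => sumSnd (f t)) :
    Continuous f :=
  isInducing_sum.continuous_iff.2 (h₁.prodMk h₂)

theorem IsIso.sum : IsIso E E' → IsIso F F' → IsIso (sum E F) (sum E' F') :=
  fun ⟨φ, h, h'⟩ ⟨ψ, k, k'⟩ => ⟨fun x => HilbertSum.congr (φ x) (ψ x),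
    continuous_sum_rng (h.comp continuous_sum_fst) (k.comp continuous_sum_snd),
    continuous_sum_rng (h'.comp continuous_sum_fst) (k'.comp continuous_sum_snd)⟩

variable (E F G)

theorem isIso_comm : IsIso (sum E F) (sum F E) :=
  ⟨fun x => HilbertSum.comm A (E.Fiber x) (F.Fiber x),
    continuous_sum_rng continuous_sum_snd continuous_sum_fst,
    continuous_sum_rng continuous_sum_snd continuous_sum_fst⟩

theorem isIso_assoc : IsIso (sum (sum E F) G) (sum E (sum F G)) := by
  have h1 := (continuous_sum_fst (E := E) (F := F)).comp
    (continuous_sum_fst (E := sum E F) (F := G))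
  have h2 := (continuous_sum_snd (E := E) (F := F)).comp
    (continuous_sum_fst (E := sum E F) (F := G))
  have h3 := (continuous_sum_fst (E := F) (F := G)).comp
    (continuous_sum_snd (E := E) (F := sum F G))
  have h4 := (continuous_sum_snd (E := F) (F := G)).comp
    (continuous_sum_snd (E := E) (F := sum F G))
  exact ⟨fun x => HilbertSum.assoc A (E.Fiber x) (F.Fiber x) (G.Fiber x),
    continuous_sum_rng h1 (continuous_sum_rng h2 continuous_sum_snd),
    continuous_sum_rng (continuous_sum_rng continuous_sum_fst h3) h4⟩

theorem isIso_zero_sum : IsIso (sum (zero A X) E) E :=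
  ⟨fun x => HilbertSum.zeroSum A (E.Fiber x), continuous_sum_snd,
    continuous_sum_rng (continuous_induced_rng.2 E.continuous_base) continuous_id⟩

end Sum

/-! ### Continuous sections -/

/-- Continuity of a section can be checked in local trivializations. -/
theorem continuous_localRep {E : HilbertBundle A X} {s : ∀ x, E.Fiber x}
    (hs : Continuous fun x => (⟨x, s x⟩ : E.Total)) {U : Set X} {V : Type*} [NormedAddCommGroup V]
    [Module Aᵐᵒᵖ V] [HilbertModule A V] {φ : ∀ x : U, HilbertModuleIso A (E.Fiber x) V}
    (hφ : IsLocalTrivialization φ) : Continuous fun x : U => (φ x).toLinearEquiv (s x) :=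
  continuous_snd.comp (hφ.continuous_toFun.comp
    ((hs.comp continuous_subtype_val).subtype_mk fun x : U => x.2))

theorem continuousAt_of_localRep {E : HilbertBundle A X} {s : ∀ x, E.Fiber x} {U : Set X}
    (hU : IsOpen U) {x₀ : X} (hx : x₀ ∈ U) {V : Type*} [NormedAddCommGroup V]
    [Module Aᵐᵒᵖ V] [HilbertModule A V] {φ : ∀ x : U, HilbertModuleIso A (E.Fiber x) V}
    (hφ : IsLocalTrivialization φ) (h : Continuous fun x : U => (φ x).toLinearEquiv (s x)) :
    ContinuousAt (fun x => (⟨x, s x⟩ : E.Total)) x₀ := by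
  have h1 := continuous_subtype_val.comp (hφ.continuous_invFun.comp (continuous_id.prodMk h))
  have h2 : Continuous ((fun x => (⟨x, s x⟩ : E.Total)) ∘ (Subtype.val : U → X)) := by
    convert! h1 using 1
    funext x
    simp
  exact (hU.isOpenEmbedding_subtypeVal.continuousAt_iff (x := ⟨x₀, hx⟩)).1 h2.continuousAt

variable (E : HilbertBundle A X)

/-- The continuous sections of a bundle, with pointwise addition. -/
def sections : AddSubgroup (∀ x, E.Fiber x) where
  carrier := {s | Continuous fun x => (⟨x, s x⟩ : E.Total)}
  zero_mem' := continuous_iff_continuousAt.2 fun x₀ => by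
    obtain ⟨U, hU, hx, V, _, _, _, φ, hφ⟩ := E.exists_trivialization x₀
    exact continuousAt_of_localRep hU hx hφ (by simpa using continuous_const)
  add_mem' := fun {s t} hs ht => continuous_iff_continuousAt.2 fun x₀ => by
    obtain ⟨U, hU, hx, V, _, _, _, φ, hφ⟩ := E.exists_trivialization x₀
    refine continuousAt_of_localRep hU hx hφ ?_
    simp only [Pi.add_apply, map_add]
    exact (continuous_localRep hs hφ).add (continuous_localRep ht hφ)
  neg_mem' := fun {s} hs => continuous_iff_continuousAt.2 fun x₀ => by
    obtain ⟨U, hU, hx, V, _, _, _, φ, hφ⟩ := E.exists_trivialization x₀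
    refine continuousAt_of_localRep hU hx hφ ?_
    simp only [Pi.neg_apply, map_neg]
    exact (continuous_localRep hs hφ).neg

/-- The continuous sections form a right `C(X, A)`-module, with `(s • f) x = s x • f x`. -/
instance sectionsModule : Module C(X, A)ᵐᵒᵖ E.sections where
  smul f s := ⟨fun x => op (f.unop x) • s.1 x, continuous_iff_continuousAt.2 fun x₀ => by
    obtain ⟨U, hU, hx, V, _, _, _, φ, hφ⟩ := E.exists_trivialization x₀
    refine continuousAt_of_localRep hU hx hφ ?_
    have := HilbertModule.continuousSMul A V
    simp only [map_smul]
    exact (continuous_op.comp (f.unop.continuous.comp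
      (continuous_subtype_val (p := fun x => x ∈ U)))).smul (continuous_localRep s.2 hφ)⟩
  one_smul s := Subtype.ext (funext fun x => one_smul Aᵐᵒᵖ (s.1 x))
  mul_smul f g s := Subtype.ext (funext fun x =>
    mul_smul (op (f.unop x)) (op (g.unop x)) (s.1 x))
  smul_zero f := Subtype.ext (funext fun x => smul_zero (op (f.unop x)))
  smul_add f s t := Subtype.ext (funext fun x => smul_add (op (f.unop x)) (s.1 x) (t.1 x))
  add_smul f g s := Subtype.ext (funext fun x =>
    add_smul (op (f.unop x)) (op (g.unop x)) (s.1 x))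
  zero_smul s := Subtype.ext (funext fun x => zero_smul Aᵐᵒᵖ (s.1 x))

end HilbertBundle

/-! ### The K-group of finitely generated projective Hilbert module bundles -/

/-- A finitely generated projective Hilbert `A`-module bundle: all fibers are so. -/
structure FGPBundle (A : Type v) [CStarAlgebra A] [PartialOrder A] (X : Type u)
    [TopologicalSpace X] extends HilbertBundle A X where
  isFGP (x : X) : HilbertModule.IsFGP A (toHilbertBundle.Fiber x)

section BundleK

variable (A : Type v) [CStarAlgebra A] [PartialOrder A] (X : Type u) [TopologicalSpace X]

instance FGPBundle.setoid : Setoid (FGPBundle A X) where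
  r E F := HilbertBundle.IsIso E.toHilbertBundle F.toHilbertBundle
  iseqv := ⟨fun _ => .refl _, .symm, .trans⟩

/-- The set of isomorphism classes of finitely generated projective Hilbert `A`-module bundles. -/
def BundleClass : Type max u (v + 1) (u + 1) := Quotient (FGPBundle.setoid A X)

variable [StarOrderedRing A]

/-- The direct sum of two finitely generated projective bundles. -/
def FGPBundle.sum {A : Type v} [CStarAlgebra A] [PartialOrder A] [StarOrderedRing A] {X : Type u}
    [TopologicalSpace X] (E F : FGPBundle A X) : FGPBundle A X :=
  ⟨.sum E.toHilbertBundle F.toHilbertBundle, fun x => HilbertSum.isFGP (E.isFGP x) (F.isFGP x)⟩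

/-- Addition of isomorphism classes is given by the direct sum of bundles. -/
instance : Add (BundleClass A X) :=
  ⟨Quotient.map₂ FGPBundle.sum fun _ _ h _ _ k => HilbertBundle.IsIso.sum h k⟩

instance : Zero (BundleClass A X) := ⟨⟦⟨.zero A X, fun _ => HilbertModule.isFGP_punit⟩⟧⟩

instance : AddCommMonoid (BundleClass A X) where
  nsmul := nsmulRec
  add_assoc := by
    rintro ⟨E⟩ ⟨F⟩ ⟨G⟩
    exact Quotient.sound (HilbertBundle.isIso_assoc _ _ _)
  zero_add := by
    rintro ⟨E⟩
    exact Quotient.sound (HilbertBundle.isIso_zero_sum _)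
  add_zero := by
    rintro ⟨E⟩
    exact Quotient.sound ((HilbertBundle.isIso_comm _ _).trans (HilbertBundle.isIso_zero_sum _))
  add_comm := by
    rintro ⟨E⟩ ⟨F⟩
    exact Quotient.sound (HilbertBundle.isIso_comm _ _)

/-- The K-theory `K(X; A)` of `X` with coefficients in `A`. -/
abbrev BundleK : Type max u (v + 1) (u + 1) := Algebra.GrothendieckAddGroup (BundleClass A X)

variable {A X}

/-- The class of a bundle in `K(X; A)`. -/
def FGPBundle.toK (E : FGPBundle A X) : BundleK A X :=
  Algebra.GrothendieckAddGroup.of (Quotient.mk _ E : BundleClass A X)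

end BundleK

/-! ### `K₀` of a ring -/

/-- A finitely generated projective right module over a ring. -/
structure FGPModule (R : Type w) [Ring R] where
  carrier : Type w
  [addCommGroup : AddCommGroup carrier]
  [module : Module Rᵐᵒᵖ carrier]
  finite : Module.Finite Rᵐᵒᵖ carrier
  projective : Module.Projective Rᵐᵒᵖ carrier

attribute [instance] FGPModule.addCommGroup FGPModule.module FGPModule.finite FGPModule.projective

section KZero

variable (R : Type w) [Ring R]

instance FGPModule.setoid : Setoid (FGPModule R) where
  r M N := Nonempty (M.carrier ≃ₗ[Rᵐᵒᵖ] N.carrier)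
  iseqv := ⟨fun _ => ⟨.refl _ _⟩, fun ⟨e⟩ => ⟨e.symm⟩, fun ⟨e⟩ ⟨f⟩ => ⟨e.trans f⟩⟩

/-- The set of isomorphism classes of finitely generated projective right `R`-modules. -/
def ModuleClass : Type (w + 1) := Quotient (FGPModule.setoid R)

/-- Addition of isomorphism classes is given by the direct sum of modules. -/
instance : Add (ModuleClass R) :=
  ⟨Quotient.map₂ (fun M N => ⟨M.carrier × N.carrier, inferInstance, inferInstance⟩)
    fun _ _ ⟨e⟩ _ _ ⟨f⟩ => ⟨e.prodCongr f⟩⟩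

instance : Zero (ModuleClass R) := ⟨⟦⟨PUnit, inferInstance, inferInstance⟩⟧⟩

instance : AddCommMonoid (ModuleClass R) where
  nsmul := nsmulRec
  add_assoc := by
    rintro ⟨M⟩ ⟨N⟩ ⟨P⟩
    exact Quotient.sound ⟨LinearEquiv.prodAssoc Rᵐᵒᵖ M.carrier N.carrier P.carrier⟩
  zero_add := by
    rintro ⟨M⟩
    exact Quotient.sound ⟨LinearEquiv.uniqueProd⟩
  add_zero := by
    rintro ⟨M⟩
    exact Quotient.sound ⟨LinearEquiv.prodUnique⟩
  add_comm := by
    rintro ⟨M⟩ ⟨N⟩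
    exact Quotient.sound ⟨LinearEquiv.prodComm Rᵐᵒᵖ M.carrier N.carrier⟩

/-- `K₀(R)`, the Grothendieck group of finitely generated projective right `R`-modules. -/
abbrev KZero : Type (w + 1) := Algebra.GrothendieckAddGroup (ModuleClass R)

variable {R}

/-- The class of a module in `K₀(R)`. -/
def FGPModule.toK (M : FGPModule R) : KZero R :=
  Algebra.GrothendieckAddGroup.of (Quotient.mk _ M : ModuleClass R)

end KZero

/-! ### The minimal C⋆-norm on a tensor product -/

/-- The tensor product of representations of `A` and `B` on Hilbert spaces `H` and `K`: the linear
map sending `a ⊗ b` to the bounded operator `π a ⊗ ρ b` on the algebraic tensor product of `H` and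
`K`, which is a dense subspace of the Hilbert space tensor product. -/
def tensorRep {A : Type*} {B : Type*} [CStarAlgebra A] [CStarAlgebra B] {H K : Type*}
    [NormedAddCommGroup H] [InnerProductSpace ℂ H] [CompleteSpace H]
    [NormedAddCommGroup K] [InnerProductSpace ℂ K] [CompleteSpace K]
    (π : A →⋆ₐ[ℂ] (H →L[ℂ] H)) (ρ : B →⋆ₐ[ℂ] (K →L[ℂ] K)) :
    A ⊗[ℂ] B →ₗ[ℂ] ((H ⊗[ℂ] K) →L[ℂ] (H ⊗[ℂ] K)) :=
  TensorProduct.lift <| LinearMap.mk₂ ℂ (fun a b => TensorProduct.mapL (π a) (ρ b))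
    (fun _ _ _ => by rw [map_add, TensorProduct.mapL_add_left])
    (fun _ _ _ => by rw [map_smul, TensorProduct.mapL_smul_left])
    (fun _ _ _ => by rw [map_add, TensorProduct.mapL_add_right])
    (fun _ _ _ => by rw [map_smul, TensorProduct.mapL_smul_right])

/-- The minimal (spatial) C⋆-norm of an element of the algebraic tensor product of two C⋆-algebras:
the supremum of the operator norms of its images under all tensor products of representations. -/
def minTensorNorm {A : Type u} {B : Type v} [CStarAlgebra A] [CStarAlgebra B] (t : A ⊗[ℂ] B) :
    ℝ≥0∞ :=
  ⨆ (H : Type u) (_ : NormedAddCommGroup H) (_ : InnerProductSpace ℂ H) (_ : CompleteSpace H)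
    (K : Type v) (_ : NormedAddCommGroup K) (_ : InnerProductSpace ℂ K) (_ : CompleteSpace K)
    (π : A →⋆ₐ[ℂ] (H →L[ℂ] H)) (ρ : B →⋆ₐ[ℂ] (K →L[ℂ] K)), ‖tensorRep π ρ t‖ₑ

end

noncomputable section

set_option linter.unusedSectionVars false

/-! ### Partitions of unity -/

/-! The K-theory statement is a Serre–Swan theorem: taking sections is already a bijection on
isomorphism classes and respects direct sums, so the Grothendieck groups agree
(`sectionsClass_bijective`). The working notion is a frame: an isometric embedding of each fiber
into `A ^ ι` whose adjoint is a left inverse. A finitely generated projective fiber has one, a local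
trivialization spreads it over an open set, and functions with `∑ (s k)² = 1` glue the local frames
(`FGPBundle.exists_frame`). A global frame makes the sections a retract of `C(X, A) ^ ι`, hence
finitely generated projective, and encodes the bundle as a continuous projection-valued map on `X`.

Surjectivity: a finitely generated projective module is cut out by an idempotent matrix over `C(X,
A)`. Kaplansky's formula turns its values continuously into projections with the same ranges, and
such ranges form a bundle (`HilbertBundle.exists_sectionsEquiv_of_retract`). Injectivity: an
isomorphism of section modules need not preserve inner products, but its matrix is invertible
relative to the two projections, so its polar part is a continuous family of partial isometries
between them (`HilbertBundle.isIso_of_sectionsEquiv`). The same polar decomposition yields local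
triviality of the bundle of ranges.

For the tensor product, let `ι` be the canonical map to `C(X, A)`. Partitions of unity approximate
`t` by sums `∑ f i ⊗ ι t (c i)`; positivity of the `f i` then bounds every `‖j t‖` by `‖ι t‖`
(`norm_map_le_norm_tensorToFun`). If `j` is injective, a nonzero elementary tensor localized near a
point and near the top of the spectrum of the value there gives the reverse bound
(`norm_tensorToFun_star_mul_self_le`). For the minimal norm, the upper bound applies to every tensor
product of representations, and point evaluations tensored with GNS representations attain it. -/

/-- On a compact Hausdorff space every neighbourhood assignment admits a finite partition of unity
subordinate to it. -/
theorem exists_finite_partition_of_unity {X : Type*} [TopologicalSpace X] [CompactSpace X]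
    [T2Space X] (U : X → Set X) (hU : ∀ x, IsOpen (U x)) (hx : ∀ x, x ∈ U x) :
    ∃ (n : ℕ) (c : Fin n → X) (f : Fin n → C(X, ℝ)), (∀ i, tsupport (f i) ⊆ U (c i)) ∧
      (∀ x, ∑ i, f i x = 1) ∧ ∀ i x, 0 ≤ f i x := by
  obtain ⟨t, ht⟩ := isCompact_univ.elim_finite_subcover U hU
    fun x _ => Set.mem_iUnion.2 ⟨x, hx x⟩
  let c : Fin t.card → X := fun i => (t.equivFin.symm i).1
  obtain ⟨f, hf, hsum, hpos, -⟩ := exists_continuous_sum_one_of_isOpen_isCompact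
    (s := fun i => U (c i)) (fun i => hU _) isCompact_univ (fun x hx => by
      obtain ⟨y, hy, hxy⟩ := Set.mem_iUnion₂.1 (ht hx)
      exact Set.mem_iUnion.2 ⟨t.equivFin ⟨y, hy⟩, by simpa [c] using hxy⟩)
  refine ⟨t.card, c, f, hf, fun x => ?_, fun i x => (hpos i x).1⟩
  simpa using hsum (Set.mem_univ x)

/-! ### Projections in C⋆-algebras -/

section Ring

variable {M : Type*} [Ring M] [StarRing M]

/-- If `c = t⋆t + (1 - p)` is invertible with self-adjoint inverse square root `w`, then `t w` is a
partial isometry with initial projection `p` and final projection `q`. -/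
theorem partialIsometry_of_invSqrt {t p q w : M} (hp : IsStarProjection p)
    (hq : IsStarProjection q) (htp : t * p = t) (hqt : q * t = t) (hw : IsSelfAdjoint w)
    (hwp : Commute w p) (hwc : Commute w (star t * t + (1 - p)))
    (hinv : w * w * (star t * t + (1 - p)) = 1) (hd : IsUnit (t * star t + (1 - q))) :
    star (t * w) * (t * w) = p ∧ (t * w) * star (t * w) = q := by
  have hp2 : p * p = p := hp.isIdempotentElem
  have hps : star p = p := hp.isSelfAdjoint
  have hq2 : q * q = q := hq.isIdempotentElem
  have hqs : star q = q := hq.isSelfAdjoint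
  have hws : star w = w := hw
  have hpt : p * star t = star t := by rw [← hps, ← star_mul, htp]
  have htq : star t * q = star t := by rw [← hqs, ← star_mul, hqt]
  set c := star t * t + (1 - p) with hc
  have hcp : p * c = star t * t := by
    rw [hc, mul_add, mul_sub, hp2, ← mul_assoc, hpt]; simp
  have hwcw : w * c * w = 1 := by rw [mul_assoc, ← hwc.eq, ← mul_assoc, hinv]
  have hcww : c * (w * w) = 1 := by rw [← mul_assoc, ← hwc.eq, hwcw]
  constructor
  · calc star (t * w) * (t * w) = w * (star t * t) * w := by rw [star_mul, hws]; noncomm_ring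
      _ = p * (w * c * w) := by rw [← hcp, ← mul_assoc, hwp.eq]; noncomm_ring
      _ = p := by rw [hwcw, mul_one]
  · have e0 : t * w * star (t * w) = t * (w * w) * star t := by
      rw [star_mul, hws]; noncomm_ring
    -- Here `t⋆t = c - (1 - p)` and `w²c = 1`; the remaining term dies because `t (1 - p) = 0`.
    have e1 : t * (w * w) * star t * t = t := by
      have h1 : w * w * (1 - p) = (1 - p) * (w * w) := by
        have := (hwp.mul_left hwp).eq
        rw [mul_sub, sub_mul, this]; simp
      calc t * (w * w) * star t * t = t * (w * w * (c - (1 - p))) := by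
            rw [hc]; noncomm_ring
        _ = t * (1 - (1 - p) * (w * w)) := by rw [mul_sub, hinv, h1]
        _ = t - (t - t * p) * (w * w) := by noncomm_ring
        _ = t := by rw [htp]; simp
    rw [e0]
    -- Both sides times the unit `t t⋆ + (1 - q)` equal `t t⋆`. Invertibility on the target side is
    -- what makes the final projection all of `q`.
    refine hd.mul_right_cancel ?_
    have e2 : t * (w * w) * star t * q = t * (w * w) * star t := by rw [mul_assoc, htq]
    have l : t * (w * w) * star t * (t * star t + (1 - q)) = t * star t := by
      rw [mul_add, mul_sub, e2, ← mul_assoc, e1]; simp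
    have r : q * (t * star t + (1 - q)) = t * star t := by
      rw [mul_add, mul_sub, hq2, ← mul_assoc, hqt]; simp
    rw [l, r]

/-- If `t'` is inverse to `t` relative to projections `p` and `q`, then `t⋆t + (1 - p)` is
invertible. -/
theorem isUnit_star_mul_self_add {t t' p q : M} (hp : IsStarProjection p)
    (hq : IsStarProjection q) (htp : t * p = t) (hqt : q * t = t) (hpt' : p * t' = t')
    (h : t' * t = p) (h' : t * t' = q) : IsUnit (star t * t + (1 - p)) := by
  have hp2 : p * p = p := hp.isIdempotentElem
  have hps : star p = p := hp.isSelfAdjoint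
  have hqs : star q = q := hq.isSelfAdjoint
  have htq : star t * q = star t := by rw [← hqs, ← star_mul, hqt]
  have htp' : star t' * p = star t' := by rw [← hps, ← star_mul, hpt']
  -- The inverse is `t' t'⋆ + (1 - p)`. Both factors are self-adjoint, so the adjoint of this
  -- identity gives the other side.
  have e : (star t * t + (1 - p)) * (t' * star t' + (1 - p)) = 1 := by
    have h1 : star t * t * (t' * star t') = p := by
      rw [mul_assoc, ← mul_assoc t, h', ← mul_assoc, htq, ← star_mul, h, hps]
    have h2 : star t * t * (1 - p) = 0 := by
      rw [mul_sub, mul_one, mul_assoc, htp, sub_self]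
    have h3 : (1 - p) * (t' * star t') = 0 := by
      rw [sub_mul, one_mul, ← mul_assoc, hpt', sub_self]
    have h4 : (1 - p) * (1 - p) = 1 - p := by
      rw [mul_sub, mul_one, sub_mul, one_mul, hp2, sub_self, sub_zero]
    rw [add_mul, mul_add, mul_add, h1, h2, h3, h4]; simp
  have e' := congrArg star e
  have s1 : star (star t * t + (1 - p)) = star t * t + (1 - p) := by simp [hps]
  have s2 : star (t' * star t' + (1 - p)) = t' * star t' + (1 - p) := by simp [hps]
  rw [star_mul, s1, s2, star_one] at e'
  exact ⟨⟨_, _, e, e'⟩, rfl⟩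

/-- Kaplansky's formula: the projection with the same range as an idempotent `e`. -/
theorem isStarProjection_of_idempotent {e k : M} (he : e * e = e)
    (hk : k = 1 + (e - star e) * (star e - e)) {l : M} (hkl : k * l = 1) (hlk : l * k = 1) :
    IsStarProjection (e * star e * l) ∧ e * (e * star e * l) = e * star e * l ∧
      e * star e * l * e = e := by
  have he' : star e * star e = star e := by rw [← star_mul, he]
  have hks : star k = k := by
    rw [hk]; simp only [star_add, star_one, star_mul, star_sub, star_star]
  have hls : star l = l := by
    have h := congrArg star hkl
    rw [star_mul, hks, star_one] at h
    calc star l = star l * (k * l) := by rw [hkl, mul_one]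
      _ = l := by rw [← mul_assoc, h, one_mul]
  have hk' : k = 1 + (e * star e - e * e - star e * star e + star e * e) := by
    rw [hk]; noncomm_ring
  rw [he, he'] at hk'
  -- Both `e k` and `k e` collapse to `e e⋆ e`. Thus the self-adjoint `k`, and with it its inverse
  -- `l`, commutes with `e` and `e⋆`.
  have h1 : e * k = e * star e * e := by
    rw [hk', mul_add, mul_add, mul_sub, mul_sub, ← mul_assoc, ← mul_assoc, he]; noncomm_ring
  have h2 : k * e = e * star e * e := by
    rw [hk', add_mul, add_mul, sub_mul, sub_mul, mul_assoc (star e), he]; noncomm_ring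
  have hc : Commute k e := h2.trans h1.symm
  have hc' : Commute k (star e) := by
    have := hc.star_star; rwa [hks] at this
  have comm_l : ∀ {x : M}, Commute k x → Commute l x := fun {x} hx => by
    show l * x = x * l
    calc l * x = l * (x * k) * l := by rw [mul_assoc, mul_assoc, hkl, mul_one]
      _ = x * l := by rw [← hx.eq, ← mul_assoc, hlk, one_mul]
  have hle := comm_l hc
  have hle' := comm_l hc'
  have key : e * star e * l * e = e := by
    rw [mul_assoc, hle.eq, ← mul_assoc, ← h1, mul_assoc, hkl, mul_one]
  refine ⟨⟨?_, ?_⟩, by simp only [← mul_assoc, he], key⟩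
  · show e * star e * l * (e * star e * l) = _
    rw [← mul_assoc, ← mul_assoc, key]
  · show star (e * star e * l) = _
    rw [star_mul, star_mul, star_star, hls, ← mul_assoc, hle.eq, mul_assoc, hle'.eq, mul_assoc]

end Ring

/-! ### Continuous families of partial isometries and projections -/

section CStar

variable {M : Type*} [CStarAlgebra M]

/-- The element is a sum of two positive ones, and invertibility excludes `0`. This places the
spectrum where `s ↦ 1 / √s` is continuous. -/
theorem spectrum_star_mul_self_add_subset {t p : M} (hp : IsStarProjection p)
    (hc : IsUnit (star t * t + (1 - p))) :
    spectrum ℝ (star t * t + (1 - p)) ⊆ Set.Ioi 0 := by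
  let := CStarAlgebra.spectralOrder M
  have := CStarAlgebra.spectralOrderedRing M
  have hn : 0 ≤ star t * t + (1 - p) :=
    add_nonneg (star_mul_self_nonneg t) hp.one_sub.nonneg
  intro s hs
  have h0 : (0 : ℝ) ∉ spectrum ℝ (star t * t + (1 - p)) := spectrum.zero_notMem ℝ hc
  exact lt_of_le_of_ne (spectrum_nonneg_of_nonneg hn hs) fun h => h0 (h ▸ hs)

/-- A continuous family of elements `T y`, invertible relative to projections `P y` and `Q y`, has
a continuous family of polar parts, which are partial isometries from `P y` to `Q y`. -/
theorem exists_continuous_partialIsometry {Y : Type*} [TopologicalSpace Y] {T P Q : Y → M}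
    (hT : Continuous T) (hP : Continuous P)
    (hp : ∀ y, IsStarProjection (P y)) (hq : ∀ y, IsStarProjection (Q y))
    (htp : ∀ y, T y * P y = T y) (hqt : ∀ y, Q y * T y = T y)
    (hc : ∀ y, IsUnit (star (T y) * T y + (1 - P y)))
    (hd : ∀ y, IsUnit (T y * star (T y) + (1 - Q y))) :
    ∃ U : Y → M, Continuous U ∧ ∀ y, star (U y) * U y = P y ∧ U y * star (U y) = Q y := by
  let g : ℝ → ℝ := fun s => 1 / √s
  let c : Y → M := fun y => star (T y) * T y + (1 - P y)
  have hg : ContinuousOn g (Set.Ioi 0) := fun s hs =>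
    (ContinuousAt.div continuousAt_const Real.continuous_sqrt.continuousAt
      (Real.sqrt_pos.2 hs).ne').continuousWithinAt
  have hsa : ∀ y, IsSelfAdjoint (c y) := fun y =>
    (IsSelfAdjoint.star_mul_self _).add ((IsSelfAdjoint.one M).sub (hp y).isSelfAdjoint)
  have hsp : ∀ y, spectrum ℝ (c y) ⊆ Set.Ioi 0 := fun y =>
    spectrum_star_mul_self_add_subset (hp y) (hc y)
  have hcont : Continuous c := by fun_prop
  refine ⟨fun y => T y * cfc g (c y), hT.mul ?_, fun y => ?_⟩
  -- The spectra need not stay uniformly away from `0`; it suffices that all lie in the open set on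
  -- which `g` is continuous.
  · refine Continuous.cfc_of_mem_nhdsSet (s := Set.Ioi 0) g ?_ hcont hsa hg
    exact isOpen_Ioi.mem_nhdsSet.2 (Set.iUnion_subset hsp)
  · have hgy : ContinuousOn g (spectrum ℝ (c y)) := hg.mono (hsp y)
    refine partialIsometry_of_invSqrt (hp y) (hq y) (htp y) (hqt y) (cfc_predicate g (c y)) ?_ ?_
      ?_ (hd y)
    · have : Commute (c y) (P y) := by
        have h2 : P y * star (T y) = star (T y) := by
          have := congrArg star (htp y)
          rwa [star_mul, (hp y).isSelfAdjoint.star_eq] at this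
        show (star (T y) * T y + (1 - P y)) * P y = P y * (star (T y) * T y + (1 - P y))
        rw [add_mul, mul_add, mul_assoc, htp, ← mul_assoc, h2]
        noncomm_ring
      exact (this.cfc_real g)
    · exact (Commute.refl (c y)).cfc_real g
    · show cfc g (c y) * cfc g (c y) * c y = 1
      -- Writing the last factor as a functional calculus too reduces the claim to `s^(-1/2)
      -- s^(-1/2) s = 1` on the spectrum.
      have hid : cfc (id : ℝ → ℝ) (c y) = c y := cfc_id ℝ (c y) (hsa y)
      conv_lhs => rw [← hid, hid]
      nth_rw 3 [← hid]
      rw [← cfc_mul g g (c y) hgy hgy, ← cfc_mul (fun x => g x * g x) _ (c y) (hgy.mul hgy)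
        continuousOn_id]
      rw [← cfc_const_one ℝ (c y) (hsa y)]
      refine cfc_congr fun s hs => ?_
      have hs' : (0 : ℝ) < s := hsp y hs
      have : √s * √s = s := Real.mul_self_sqrt hs'.le
      have h0 : √s ≠ 0 := (Real.sqrt_pos.2 hs').ne'
      show 1 / √s * (1 / √s) * s = 1
      field_simp
      nlinarith

/-- The projections with the same ranges as a continuous family of idempotents depend
continuously on the parameter. -/
theorem exists_continuous_starProjection {Y : Type*} [TopologicalSpace Y] {E : Y → M}
    (hE : Continuous E) (he : ∀ y, E y * E y = E y) :
    ∃ P : Y → M, Continuous P ∧ ∀ y, IsStarProjection (P y) ∧ E y * P y = P y ∧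
      P y * E y = E y := by
  let := CStarAlgebra.spectralOrder M
  have := CStarAlgebra.spectralOrderedRing M
  let k : Y → M := fun y => 1 + (E y - star (E y)) * (star (E y) - E y)
  -- Since `E⋆ - E = (E - E⋆)⋆`, the element is `1` plus something positive, hence at least `1`.
  have hk : ∀ y, IsUnit (k y) := fun y => by
    have h : k y = 1 + (E y - star (E y)) * star (E y - star (E y)) := by simp [k]
    have h0 : 0 ≤ (E y - star (E y)) * star (E y - star (E y)) := mul_star_self_nonneg _
    have h1 : (1 : M) ≤ k y := by rw [h]; exact le_add_of_nonneg_right h0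
    exact CStarAlgebra.isUnit_of_le (1 : M) h1 ⟨zero_le_one, isUnit_one⟩
  refine ⟨fun y => E y * star (E y) * Ring.inverse (k y), ?_, fun y => ?_⟩
  · refine (by fun_prop : Continuous fun y => E y * star (E y)).mul ?_
    refine continuous_iff_continuousAt.2 fun y => ?_
    obtain ⟨z, hz⟩ := hk y
    have h1 := NormedRing.inverse_continuousAt z
    rw [hz] at h1
    exact h1.comp (f := k) (by fun_prop : Continuous k).continuousAt
  · exact isStarProjection_of_idempotent (he y) rfl (Ring.mul_inverse_cancel _ (hk y))
      (Ring.inverse_mul_cancel _ (hk y))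

end CStar

/-! ### Grothendieck groups -/

/-- Isomorphic monoids have isomorphic Grothendieck groups. -/
theorem exists_grothendieckAddGroup_equiv {M N : Type*} [AddCommMonoid M] [AddCommMonoid N]
    (e : M ≃+ N) : ∃ s : Algebra.GrothendieckAddGroup M ≃+ Algebra.GrothendieckAddGroup N,
      ∀ m, s (Algebra.GrothendieckAddGroup.of m) = Algebra.GrothendieckAddGroup.of (e m) := by
  let f := Algebra.GrothendieckAddGroup.lift
    ((Algebra.GrothendieckAddGroup.of (M := N)).comp e.toAddMonoidHom)
  let g := Algebra.GrothendieckAddGroup.lift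
    ((Algebra.GrothendieckAddGroup.of (M := M)).comp e.symm.toAddMonoidHom)
  have hf : ∀ m, f (Algebra.GrothendieckAddGroup.of m) = Algebra.GrothendieckAddGroup.of (e m) :=
    fun m => DFunLike.congr_fun (Algebra.GrothendieckAddGroup.lift.symm_apply_apply
      ((Algebra.GrothendieckAddGroup.of (M := N)).comp e.toAddMonoidHom)) m
  have hg : ∀ m, g (Algebra.GrothendieckAddGroup.of m) =
      Algebra.GrothendieckAddGroup.of (e.symm m) :=
    fun m => DFunLike.congr_fun (Algebra.GrothendieckAddGroup.lift.symm_apply_apply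
      ((Algebra.GrothendieckAddGroup.of (M := M)).comp e.symm.toAddMonoidHom)) m
  refine ⟨AddMonoidHom.toAddEquiv f g ?_ ?_, hf⟩
  · refine Algebra.GrothendieckAddGroup.lift.symm.injective (AddMonoidHom.ext fun m => ?_)
    show g (f (Algebra.GrothendieckAddGroup.of m)) = Algebra.GrothendieckAddGroup.of m
    rw [hf, hg, e.symm_apply_apply]
  · refine Algebra.GrothendieckAddGroup.lift.symm.injective (AddMonoidHom.ext fun m => ?_)
    show f (g (Algebra.GrothendieckAddGroup.of m)) = Algebra.GrothendieckAddGroup.of m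
    rw [hg, hf, e.apply_symm_apply]

/-! ### Frames of Hilbert modules -/

section Frames

open scoped Matrix

/-- A frame of a Hilbert `A`-module indexed by a finite type `ι`: an adjointable isometric
embedding into `A ^ ι`, together with its adjoint. -/
structure HilbertModule.Frame (A : Type*) [CStarAlgebra A] [PartialOrder A] (V : Type*)
    [NormedAddCommGroup V] [Module Aᵐᵒᵖ V] [HilbertModule A V] (ι : Type*) [Fintype ι] where
  coord : V →ₗ[Aᵐᵒᵖ] (ι → A)
  synth : (ι → A) →ₗ[Aᵐᵒᵖ] V
  synth_coord (v : V) : synth (coord v) = v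
  inner_synth (v : V) (y : ι → A) : inner A v (synth y) = star (coord v) ⬝ᵥ y

namespace HilbertModule

variable {A : Type*} [CStarAlgebra A] [PartialOrder A] {V W : Type*}
  [NormedAddCommGroup V] [Module Aᵐᵒᵖ V] [HilbertModule A V]
  [NormedAddCommGroup W] [Module Aᵐᵒᵖ W] [HilbertModule A W]

variable (A) in
theorem inner_zero_right (v : V) : inner A v (0 : V) = 0 := by
  have h := inner_add_right (A := A) v 0 0
  rw [add_zero] at h
  simpa using h

theorem inner_sum_right {κ : Type*} (s : Finset κ) (v : V) (w : κ → V) :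
    inner A v (∑ k ∈ s, w k) = ∑ k ∈ s, inner A v (w k) :=
  map_sum (⟨⟨fun w => inner A v w, inner_zero_right A v⟩, inner_add_right v⟩ : V →+ A) w s

variable (A) in
theorem inner_sub_right (v w₁ w₂ : V) : inner A v (w₁ - w₂) = inner A v w₁ - inner A v w₂ :=
  map_sub (⟨⟨fun w => inner A v w, inner_zero_right A v⟩, inner_add_right v⟩ : V →+ A) w₁ w₂

theorem ext_inner {v w : V} (h : ∀ z : V, inner A z v = inner A z w) : v = w := by
  rw [← sub_eq_zero, ← inner_self_eq_zero (A := A), inner_sub_right, h, sub_self]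

theorem norm_sq_eq (v : V) : ‖v‖ ^ 2 = ‖inner A v v‖ := by
  rw [norm_eq_sqrt (A := A), Real.sq_sqrt (norm_nonneg _)]

namespace Frame

variable {ι : Type*} [Fintype ι] (F : Frame A V ι)

theorem inner_eq (v w : V) : inner A v w = star (F.coord v) ⬝ᵥ F.coord w := by
  rw [← F.inner_synth, F.synth_coord]

/-- Adjointness rewrites `‖synth y‖²` as the norm of a pairing of `coord (synth y)` with `y`, which
is estimated termwise. The quotient form postpones the bound on `coord`, which needs the order of
`A`. -/
theorem synth_norm_le (y : ι → A) : ‖F.synth y‖ ≤ Fintype.card ι * (‖F.coord (F.synth y)‖ * ‖y‖) /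
    ‖F.synth y‖ := by
  rcases eq_or_ne ‖F.synth y‖ 0 with h | h
  · rw [h]; simp
  rw [le_div_iff₀ (lt_of_le_of_ne (norm_nonneg _) h.symm), ← sq, norm_sq_eq (A := A), F.inner_synth]
  refine (norm_sum_le _ _).trans ?_
  rw [← nsmul_eq_mul, ← Finset.card_univ, ← Finset.sum_const]
  refine Finset.sum_le_sum fun i _ => (norm_mul_le _ _).trans ?_
  rw [Pi.star_apply, norm_star]
  gcongr <;> exact norm_le_pi_norm _ i

/-- Transport of a frame along an isomorphism. -/
def comap (φ : HilbertModuleIso A W V) : Frame A W ι where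
  coord := F.coord ∘ₗ φ.toLinearEquiv.toLinearMap
  synth := φ.toLinearEquiv.symm.toLinearMap ∘ₗ F.synth
  synth_coord v := by simp [F.synth_coord]
  inner_synth v y := by
    rw [← φ.inner_map]
    simp [F.inner_synth]

variable [StarOrderedRing A]

/-- Each `star (v i) * v i` is one summand of `⟪v, v⟫`, and all summands are positive. -/
theorem norm_coord_le (v : V) : ‖F.coord v‖ ≤ ‖v‖ := by
  refine (pi_norm_le_iff_of_nonneg (norm_nonneg _)).2 fun i => ?_
  rw [← sq_le_sq₀ (norm_nonneg _) (norm_nonneg _), norm_sq_eq (A := A) v, sq,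
    ← CStarRing.norm_star_mul_self, F.inner_eq]
  refine CStarAlgebra.norm_le_norm_of_nonneg_of_le (star_mul_self_nonneg _) ?_
  exact Finset.single_le_sum (f := fun i => star (F.coord v i) * F.coord v i)
    (fun i _ => star_mul_self_nonneg _) (Finset.mem_univ i)

theorem norm_synth_le (y : ι → A) : ‖F.synth y‖ ≤ Fintype.card ι * ‖y‖ := by
  rcases eq_or_ne ‖F.synth y‖ 0 with h | h
  · rw [h]; positivity
  refine (F.synth_norm_le y).trans ?_
  have h0 : 0 < ‖F.synth y‖ := lt_of_le_of_ne (norm_nonneg _) h.symm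
  rw [div_le_iff₀ h0]
  have := F.norm_coord_le (F.synth y)
  calc _ ≤ Fintype.card ι * (‖F.synth y‖ * ‖y‖) := by gcongr
    _ = _ := by ring

theorem continuous_coord : Continuous F.coord :=
  AddMonoidHomClass.continuous_of_bound F.coord 1 fun v => by
    rw [one_mul]; exact F.norm_coord_le v

theorem continuous_synth : Continuous F.synth :=
  AddMonoidHomClass.continuous_of_bound F.synth _ F.norm_synth_le

end Frame

/-- The orthogonal decomposition chooses, for each `y`, a vector `r y` with `⟪w, r y⟫ = ⟪i w, y⟫`
for all `w`. This determines `r y`, so the a priori arbitrary choice is linear, is adjoint to `i`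
and satisfies `r (i v) = v`. -/
theorem IsFGP.exists_frame (h : IsFGP A V) : ∃ n : ℕ, Nonempty (Frame A V (Fin n)) := by
  obtain ⟨n, i, hi, hi'⟩ := h
  choose r hr using hi'
  have key : ∀ y w, inner A w (r y) = star (i w) ⬝ᵥ y := fun y w => by
    have h := hr y w
    simp only [mul_sub, Finset.sum_sub_distrib, hi] at h
    exact (sub_eq_zero.1 h).symm
  refine ⟨n, ⟨⟨i, ⟨⟨r, fun y z => ?_⟩, fun a y => ?_⟩, fun v => ?_, fun v y => key y v⟩⟩⟩
  · refine ext_inner (A := A) fun w => ?_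
    rw [inner_add_right, key, key, key, dotProduct_add]
  · refine ext_inner (A := A) fun w => ?_
    obtain ⟨a, rfl⟩ := op_surjective a
    rw [RingHom.id_apply, inner_op_smul_right, key, key, dotProduct, dotProduct, Finset.sum_mul]
    exact Finset.sum_congr rfl fun k _ => by simp [mul_assoc]
  · refine ext_inner (A := A) fun w => ?_
    show inner A w (r (i v)) = _
    rw [key]
    exact hi w v

end HilbertModule

/-! ### Frames of bundles -/

namespace HilbertBundle

variable {A : Type v} [CStarAlgebra A] [PartialOrder A] {X : Type u} [TopologicalSpace X]

/-- A continuous frame of a bundle over a subset of the base. -/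
structure FrameOn (E : HilbertBundle A X) (U : Set X) (ι : Type*) [Fintype ι] where
  fiber (x : U) : HilbertModule.Frame A (E.Fiber x) ι
  continuous_coord : Continuous fun p : {p : E.Total // p.base ∈ U} =>
    (fiber ⟨p.1.base, p.2⟩).coord p.1.vec
  continuous_synth : Continuous fun q : U × (ι → A) =>
    (⟨q.1, (fiber q.1).synth q.2⟩ : E.Total)

/-- A continuous frame of a bundle. -/
structure Frame (E : HilbertBundle A X) (ι : Type*) [Fintype ι] where
  fiber (x : X) : HilbertModule.Frame A (E.Fiber x) ι
  continuous_coord : Continuous fun p : E.Total => (fiber p.base).coord p.vec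
  continuous_synth : Continuous fun q : X × (ι → A) =>
    (⟨q.1, (fiber q.1).synth q.2⟩ : E.Total)

/-- A frame of the typical fiber defines a frame over the domain of a local trivialization. -/
def FrameOn.ofTrivialization [StarOrderedRing A] {E : HilbertBundle A X} {U : Set X} {V : Type*}
    [NormedAddCommGroup V] [Module Aᵐᵒᵖ V] [HilbertModule A V]
    {φ : ∀ x : U, HilbertModuleIso A (E.Fiber x) V} (hφ : IsLocalTrivialization φ)
    {ι : Type*} [Fintype ι] (F : HilbertModule.Frame A V ι) : FrameOn E U ι where
  fiber x := F.comap (φ x)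
  continuous_coord := F.continuous_coord.comp (continuous_snd.comp hφ.continuous_toFun)
  continuous_synth := continuous_subtype_val.comp (hφ.continuous_invFun.comp
    (continuous_fst.prodMk (F.continuous_synth.comp continuous_snd)))

theorem exists_frameOn [StarOrderedRing A] (E : FGPBundle A X) (x₀ : X) :
    ∃ U : Set X, IsOpen U ∧ x₀ ∈ U ∧ ∃ n : ℕ, Nonempty (FrameOn E.toHilbertBundle U (Fin n)) := by
  obtain ⟨U, hU, hx, V, _, _, _, φ, hφ⟩ := E.exists_trivialization x₀
  -- Projectivity is known for the fibers, not for the typical fiber `V`; the frame at `x₀` is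
  -- carried to `V` by the trivialization.
  obtain ⟨n, ⟨F⟩⟩ := (E.isFGP x₀).exists_frame
  exact ⟨U, hU, hx, n, ⟨.ofTrivialization hφ (F.comap (φ ⟨x₀, hx⟩).symm)⟩⟩

/-! ### Continuity of maps into a total space -/

section Continuity

variable {E : HilbertBundle A X} {T : Type*} [TopologicalSpace T]

/-- A map which is continuous over an open set containing the support of `s`, and agrees with a
continuous map where `s` vanishes, is continuous. -/
theorem continuous_of_tsupport_subset {Z : Type*} [TopologicalSpace Z] {b : T → X}
    (hb : Continuous b) {U : Set X} (hU : IsOpen U) {s : X → ℝ} (hs : tsupport s ⊆ U)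
    {f g : T → Z} (hf : Continuous fun t : {t // b t ∈ U} => f t) (hg : Continuous g)
    (h : ∀ t, s (b t) = 0 → f t = g t) : Continuous f := by
  refine continuous_iff_continuousAt.2 fun t => ?_
  by_cases ht : b t ∈ U
  · exact ((hU.preimage hb).isOpenEmbedding_subtypeVal.continuousAt_iff (x := ⟨t, ht⟩)).1
      hf.continuousAt
  · have hn : (tsupport s)ᶜ ∈ nhds (b t) :=
      (isClosed_tsupport s).isOpen_compl.mem_nhds fun h => ht (hs h)
    refine hg.continuousAt.congr ?_
    filter_upwards [hb.continuousAt hn] with t' ht'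
    exact (h t' (image_eq_zero_of_notMem_tsupport ht')).symm

theorem continuous_zero_total {b : T → X} (hb : Continuous b) :
    Continuous fun t => (⟨b t, 0⟩ : E.Total) :=
  (E.sections.zero_mem : Continuous fun x => (⟨x, 0⟩ : E.Total)).comp hb

/-- Near a point, a trivialization turns fiberwise addition into addition in a fixed normed group. A
general parameter space `T` is allowed because synthesis maps are parametrized by `X × (ι → A)`. -/
theorem continuous_add_total {b : T → X} {v w : ∀ t, E.Fiber (b t)}
    (hv : Continuous fun t => (⟨b t, v t⟩ : E.Total))
    (hw : Continuous fun t => (⟨b t, w t⟩ : E.Total)) :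
    Continuous fun t => (⟨b t, v t + w t⟩ : E.Total) := by
  have hb : Continuous b := E.continuous_base.comp hv
  refine continuous_iff_continuousAt.2 fun t => ?_
  obtain ⟨U, hU, hx, V, _, _, _, φ, hφ⟩ := E.exists_trivialization (b t)
  refine ((hU.preimage hb).isOpenEmbedding_subtypeVal.continuousAt_iff (x := ⟨t, hx⟩)).1 ?_
  have rep : ∀ {z : ∀ t, E.Fiber (b t)}, (Continuous fun t => (⟨b t, z t⟩ : E.Total)) →
      Continuous fun t : b ⁻¹' U => (φ ⟨b t, t.2⟩).toLinearEquiv (z t) := fun {z} hz =>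
    continuous_snd.comp (hφ.continuous_toFun.comp
      ((hz.comp continuous_subtype_val).subtype_mk fun t : b ⁻¹' U => t.2))
  have hbU : Continuous fun t : b ⁻¹' U => (⟨b t, t.2⟩ : U) :=
    (hb.comp continuous_subtype_val).subtype_mk _
  have h1 := continuous_subtype_val.comp (hφ.continuous_invFun.comp
    (hbU.prodMk ((rep hv).add (rep hw))))
  have h2 : Continuous ((fun t => (⟨b t, v t + w t⟩ : E.Total)) ∘ Subtype.val (p := (· ∈ b ⁻¹' U)))
      := by
    convert! h1 using 1
    funext t
    simp
  exact h2.continuousAt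

theorem continuous_sum_total {b : T → X} (hb : Continuous b) {κ : Type*} (s : Finset κ)
    {v : κ → ∀ t, E.Fiber (b t)}
    (hv : ∀ k ∈ s, Continuous fun t => (⟨b t, v k t⟩ : E.Total)) :
    Continuous fun t => (⟨b t, ∑ k ∈ s, v k t⟩ : E.Total) := by
  classical
  induction s using Finset.induction_on with
  | empty => simpa using continuous_zero_total hb
  | insert k s hk ih =>
    simp only [Finset.sum_insert hk]
    exact continuous_add_total (hv k (Finset.mem_insert_self k s))
      (ih fun l hl => hv l (Finset.mem_insert_of_mem hl))

end Continuity

/-! ### Gluing local frames to a global one -/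

section Glue

open Classical in
/-- The coordinates with respect to a frame over `U`, multiplied by a function supported in `U`. -/
def FrameOn.cutCoord {E : HilbertBundle A X} {U : Set X} {ι : Type*} [Fintype ι]
    (F : FrameOn E U ι) (s : C(X, ℝ)) (x : X) : E.Fiber x →ₗ[Aᵐᵒᵖ] (ι → A) :=
  if h : x ∈ U then ((s x : ℂ) • (F.fiber ⟨x, h⟩).coord) else 0

open Classical in
/-- The adjoint of `FrameOn.cutCoord`. -/
def FrameOn.cutSynth {E : HilbertBundle A X} {U : Set X} {ι : Type*} [Fintype ι]
    (F : FrameOn E U ι) (s : C(X, ℝ)) (x : X) : (ι → A) →ₗ[Aᵐᵒᵖ] E.Fiber x :=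
  if h : x ∈ U then (F.fiber ⟨x, h⟩).synth ∘ₗ ((s x : ℂ) • LinearMap.id) else 0

variable {E : HilbertBundle A X} {U : Set X} {ι : Type*} [Fintype ι] (F : FrameOn E U ι)
  {s : C(X, ℝ)}

theorem FrameOn.inner_cutSynth (x : X) (v : E.Fiber x) (y : ι → A) :
    inner A v (F.cutSynth s x y) = star (F.cutCoord s x v) ⬝ᵥ y := by
  unfold cutSynth cutCoord
  split_ifs with h
  · simp [HilbertModule.Frame.inner_synth, star_smul]
  · simp [HilbertModule.inner_zero_right]

/-- The cut-off enters once in the coordinates and once in their adjoint, so the composite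
multiplies by `s²`. This is why gluing requires the squares to add up to one. -/
theorem FrameOn.cutSynth_cutCoord (hs : tsupport s ⊆ U) (x : X) (v : E.Fiber x) :
    F.cutSynth s x (F.cutCoord s x v) = op (algebraMap ℂ A ((s x : ℂ) ^ 2)) • v := by
  unfold cutSynth cutCoord
  split_ifs with h
  · have e : ∀ y : ι → A, (s x : ℂ) • (s x : ℂ) • y = op (algebraMap ℂ A ((s x : ℂ) ^ 2)) • y :=
      fun y => by
        funext i
        simp only [Pi.smul_apply, op_smul_eq_mul, smul_smul, ← Algebra.commutes,
          ← Algebra.smul_def, sq]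
    simp only [LinearMap.comp_apply, LinearMap.smul_apply, LinearMap.id_apply]
    rw [e, map_smul, HilbertModule.Frame.synth_coord]
  · have : s x = 0 := image_eq_zero_of_notMem_tsupport fun h' => h (hs h')
    simp [this]

theorem FrameOn.continuous_cutCoord (hU : IsOpen U) (hs : tsupport s ⊆ U) :
    Continuous fun p : E.Total => F.cutCoord s p.base p.vec := by
  refine continuous_of_tsupport_subset E.continuous_base hU hs ?_ (continuous_const (y := 0)) ?_
  · have : (fun p : {p : E.Total // p.base ∈ U} => F.cutCoord s p.1.base p.1.vec) = fun p =>
        (s p.1.base : ℂ) • (F.fiber ⟨p.1.base, p.2⟩).coord p.1.vec := by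
      funext p
      simp [cutCoord, p.2]
    rw [this]
    have := E.continuous_base
    exact (Complex.continuous_ofReal.comp (s.continuous.comp
      (this.comp continuous_subtype_val))).smul F.continuous_coord
  · intro p hp
    unfold cutCoord
    split_ifs
    · simp [hp]
    · simp

theorem FrameOn.continuous_cutSynth (hU : IsOpen U) (hs : tsupport s ⊆ U) :
    Continuous fun q : X × (ι → A) => (⟨q.1, F.cutSynth s q.1 q.2⟩ : E.Total) := by
  refine continuous_of_tsupport_subset continuous_fst hU hs ?_
    (continuous_zero_total continuous_fst) ?_
  · have : (fun q : {q : X × (ι → A) // q.1 ∈ U} =>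
        (⟨q.1.1, F.cutSynth s q.1.1 q.1.2⟩ : E.Total)) = fun q =>
        ⟨q.1.1, (F.fiber ⟨q.1.1, q.2⟩).synth ((s q.1.1 : ℂ) • q.1.2)⟩ := by
      funext q
      simp [cutSynth, q.2]
    rw [this]
    have h1 : Continuous fun q : {q : X × (ι → A) // q.1 ∈ U} => (⟨q.1.1, q.2⟩ : U) :=
      (continuous_fst.comp continuous_subtype_val).subtype_mk _
    have h2 : Continuous fun q : {q : X × (ι → A) // q.1 ∈ U} => (s q.1.1 : ℂ) • q.1.2 := by
      fun_prop
    exact F.continuous_synth.comp (h1.prodMk h2)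
  · intro q hq
    unfold cutSynth
    split_ifs
    · simp [hq]
    · simp

/-- Frames over the members of an open cover are glued by functions `s k` with `∑ k, (s k)² = 1`. -/
def Frame.glue {N : ℕ} {n : Fin N → ℕ} {U : Fin N → Set X} (hU : ∀ k, IsOpen (U k))
    (F : ∀ k, FrameOn E (U k) (Fin (n k))) (s : Fin N → C(X, ℝ))
    (hs : ∀ k, tsupport (s k) ⊆ U k) (hsum : ∀ x, ∑ k, s k x ^ 2 = 1) :
    Frame E (Σ k, Fin (n k)) where
  fiber x :=
    { coord := LinearMap.pi fun i => LinearMap.proj i.2 ∘ₗ (F i.1).cutCoord (s i.1) x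
      synth := ∑ k, (F k).cutSynth (s k) x ∘ₗ LinearMap.pi fun j => LinearMap.proj ⟨k, j⟩
      synth_coord := fun v => by
        rw [LinearMap.sum_apply]
        have : ∀ k, ((F k).cutSynth (s k) x ∘ₗ LinearMap.pi fun j =>
            LinearMap.proj (φ := fun _ : Σ k, Fin (n k) => A) (R := Aᵐᵒᵖ) ⟨k, j⟩)
            ((LinearMap.pi fun i => LinearMap.proj i.2 ∘ₗ (F i.1).cutCoord (s i.1) x) v) =
            op (algebraMap ℂ A ((s k x : ℂ) ^ 2)) • v := fun k =>
          (F k).cutSynth_cutCoord (hs k) x v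
        simp only [this]
        rw [← Finset.sum_smul, ← Finset.op_sum, ← map_sum]
        have h1 : ∑ k, (s k x : ℂ) ^ 2 = 1 := by exact_mod_cast hsum x
        rw [h1, map_one, op_one, one_smul]
      inner_synth := fun v y => by
        rw [LinearMap.sum_apply, HilbertModule.inner_sum_right, dotProduct, Fintype.sum_sigma]
        refine Finset.sum_congr rfl fun k _ => ?_
        rw [LinearMap.comp_apply, FrameOn.inner_cutSynth]
        rfl }
  continuous_coord := continuous_pi fun i =>
    (continuous_apply i.2).comp ((F i.1).continuous_cutCoord (hU i.1) (hs i.1))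
  continuous_synth := by
    simp only [LinearMap.sum_apply]
    refine continuous_sum_total continuous_fst _ fun k _ => ?_
    have h := (F k).continuous_cutSynth (hU k) (hs k)
    have h2 : Continuous fun q : X × ((Σ k, Fin (n k)) → A) =>
        (q.1, fun j : Fin (n k) => q.2 ⟨k, j⟩) := by fun_prop
    exact h.comp h2

/-- Every finitely generated projective bundle over a compact Hausdorff space has a frame. -/
theorem _root_.FGPBundle.exists_frame [StarOrderedRing A] [CompactSpace X] [T2Space X]
    (E : FGPBundle A X) : ∃ (ι : Type) (_ : Fintype ι) (_ : DecidableEq ι),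
      Nonempty (Frame E.toHilbertBundle ι) := by
  choose U hU hx n F using exists_frameOn E
  obtain ⟨N, c, f, hf, hsum, hpos⟩ := exists_finite_partition_of_unity U hU hx
  -- Square roots of a partition of unity: their squares sum to `1`, and they vanish where the
  -- original functions do.
  let s : Fin N → C(X, ℝ) := fun k => ⟨fun x => √(f k x), by fun_prop⟩
  have hs : ∀ k, tsupport (s k) ⊆ U (c k) := fun k =>
    (closure_mono fun x (hx : √(f k x) ≠ 0) => by
      intro h0
      exact hx (by rw [h0, Real.sqrt_zero])).trans (hf k)
  exact ⟨Σ k, Fin (n (c k)), inferInstance, inferInstance,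
    ⟨Frame.glue (fun k => hU (c k)) (fun k => (F (c k)).some) s hs fun x => by
      simp only [s, ContinuousMap.coe_mk, Real.sq_sqrt (hpos _ x), hsum]⟩⟩

end Glue

end HilbertBundle

end Frames

/-! ### Right modules and matrices -/

section RightModules

open scoped Matrix

variable {S : Type*} [Ring S] {ι κ : Type*} [Fintype ι] [DecidableEq ι]

/-- A ring is isomorphic to its opposite as a right module. -/
def opSelfEquiv (S : Type*) [Ring S] : S ≃ₗ[Sᵐᵒᵖ] Sᵐᵒᵖ :=
  { opAddEquiv with map_smul' := fun _ _ => rfl }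

instance : Module.Finite Sᵐᵒᵖ S := Module.Finite.equiv (opSelfEquiv S).symm

instance : Module.Free Sᵐᵒᵖ S := Module.Free.of_equiv (opSelfEquiv S).symm

theorem pi_eq_sum_op_smul_single (y : ι → S) :
    y = ∑ j, op (y j) • (Pi.single j 1 : ι → S) := by
  funext i
  simp [Finset.sum_apply, Pi.single_apply]

/-- The matrix of a map between free right modules. -/
def colMatrix (M : (ι → S) →ₗ[Sᵐᵒᵖ] (κ → S)) : Matrix κ ι S :=
  .of fun i j => M (Pi.single j 1) i

theorem colMatrix_mulVec (M : (ι → S) →ₗ[Sᵐᵒᵖ] (κ → S)) (y : ι → S) :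
    colMatrix M *ᵥ y = M y := by
  conv_rhs => rw [pi_eq_sum_op_smul_single y, map_sum]
  funext i
  simp [Matrix.mulVec, dotProduct, colMatrix, Finset.sum_apply]

theorem matrix_ext_mulVec {m m' : Matrix κ ι S} (h : ∀ y, m *ᵥ y = m' *ᵥ y) : m = m' := by
  ext i j
  simpa using congrFun (h (Pi.single j 1)) i

/-- Multiplication by a matrix as a map of right modules. -/
def Matrix.mulVecRight (m : Matrix κ ι S) : (ι → S) →ₗ[Sᵐᵒᵖ] (κ → S) where
  toFun y := m *ᵥ y
  map_add' y z := Matrix.mulVec_add m y z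
  map_smul' a y := by
    funext i
    simp [Matrix.mulVec, dotProduct, Finset.sum_mul, mul_assoc, MulOpposite.smul_eq_mul_unop]

end RightModules

/-! ### Modules of sections -/

namespace HilbertBundle

open scoped Matrix

variable {A : Type v} [CStarAlgebra A] [PartialOrder A] {X : Type u} [TopologicalSpace X]

theorem sections_add_apply {E : HilbertBundle A X} (s t : E.sections) (x : X) :
    (s + t).1 x = s.1 x + t.1 x := rfl

theorem sections_smul_apply {E : HilbertBundle A X} (f : C(X, A)ᵐᵒᵖ) (s : E.sections) (x : X) :
    (f • s).1 x = op (f.unop x) • s.1 x := rfl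

namespace Frame

variable {E : HilbertBundle A X} {ι κ : Type*} [Fintype ι] [Fintype κ] (F : Frame E ι)

/-- The coordinates of a section. -/
def sectCoord : E.sections →ₗ[C(X, A)ᵐᵒᵖ] (ι → C(X, A)) where
  toFun s i := ⟨fun x => (F.fiber x).coord (s.1 x) i,
    (continuous_apply i).comp (F.continuous_coord.comp s.2)⟩
  map_add' s t := by
    funext i; ext x
    simp [sections_add_apply]
  map_smul' f s := by
    funext i; ext x
    simp [sections_smul_apply, MulOpposite.smul_eq_mul_unop]

theorem sectCoord_apply (s : E.sections) (i : ι) (x : X) :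
    F.sectCoord s i x = (F.fiber x).coord (s.1 x) i := rfl

/-- The section with given coefficients. -/
def sectSynth : (ι → C(X, A)) →ₗ[C(X, A)ᵐᵒᵖ] E.sections where
  toFun y := ⟨fun x => (F.fiber x).synth fun i => y i x,
    F.continuous_synth.comp (continuous_id.prodMk (continuous_pi fun i => (y i).continuous))⟩
  map_add' y z := Subtype.ext <| funext fun x => by
    rw [sections_add_apply, ← map_add]; rfl
  map_smul' f y := Subtype.ext <| funext fun x => by
    rw [RingHom.id_apply, sections_smul_apply, ← map_smul]; rfl

/-- This splitting exhibits the sections as a retract of a free module of finite rank. -/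
theorem sectSynth_sectCoord (s : E.sections) : F.sectSynth (F.sectCoord s) = s :=
  Subtype.ext <| funext fun x => (F.fiber x).synth_coord (s.1 x)

theorem finite_sections [CompactSpace X] (F : Frame E ι) : Module.Finite C(X, A)ᵐᵒᵖ E.sections :=
  Module.Finite.of_surjective F.sectSynth fun s => ⟨_, F.sectSynth_sectCoord s⟩

theorem projective_sections [CompactSpace X] (F : Frame E ι) : Module.Projective C(X, A)ᵐᵒᵖ E.sections :=
  Module.Projective.of_split F.sectCoord F.sectSynth (LinearMap.ext F.sectSynth_sectCoord)

/-- Enlarging the index type of a frame. -/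
def inl (κ : Type*) [Fintype κ] : Frame E (ι ⊕ κ) where
  fiber x :=
    { coord :=
        { toFun := fun v => Sum.elim ((F.fiber x).coord v) 0
          map_add' := fun v w => by ext (i | i) <;> simp
          map_smul' := fun a v => by ext (i | i) <;> simp }
      synth := (F.fiber x).synth ∘ₗ LinearMap.funLeft Aᵐᵒᵖ A Sum.inl
      synth_coord := fun v => (F.fiber x).synth_coord v
      inner_synth := fun v y => by
        rw [LinearMap.comp_apply, (F.fiber x).inner_synth]
        simp [dotProduct] }
  continuous_coord := continuous_pi fun i => by
    rcases i with i | i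
    · exact (continuous_apply i).comp F.continuous_coord
    · exact continuous_const
  continuous_synth := F.continuous_synth.comp (g := fun q : X × (ι → A) =>
    (⟨q.1, (F.fiber q.1).synth q.2⟩ : E.Total)) (f := fun q : X × (ι ⊕ κ → A) =>
      (q.1, fun i => q.2 (Sum.inl i))) (by fun_prop)

/-- Reindexing a frame. -/
def reindex (e : ι ≃ κ) : Frame E κ where
  fiber x :=
    { coord := LinearMap.funLeft Aᵐᵒᵖ A e.symm ∘ₗ (F.fiber x).coord
      synth := (F.fiber x).synth ∘ₗ LinearMap.funLeft Aᵐᵒᵖ A e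
      synth_coord := fun v => by
        rw [LinearMap.comp_apply, LinearMap.comp_apply]
        convert (F.fiber x).synth_coord v using 2
        funext i
        simp [LinearMap.funLeft]
      inner_synth := fun v y => by
        rw [LinearMap.comp_apply, (F.fiber x).inner_synth, dotProduct, dotProduct]
        exact Fintype.sum_equiv e _ _ fun i => by simp [LinearMap.funLeft] }
  continuous_coord := continuous_pi fun i => (continuous_apply (e.symm i)).comp F.continuous_coord
  continuous_synth := F.continuous_synth.comp (g := fun q : X × (ι → A) =>
    (⟨q.1, (F.fiber q.1).synth q.2⟩ : E.Total)) (f := fun q : X × (κ → A) =>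
      (q.1, fun i => q.2 (e i))) (by fun_prop)

variable [DecidableEq ι]

/-- The projection in `Mₙ(A)` onto the range of the embedding of a fiber. -/
def proj (x : X) : Matrix ι ι A := colMatrix ((F.fiber x).coord ∘ₗ (F.fiber x).synth)

theorem proj_mulVec (x : X) (y : ι → A) :
    F.proj x *ᵥ y = (F.fiber x).coord ((F.fiber x).synth y) := colMatrix_mulVec _ y

theorem proj_mulVec_coord (x : X) (v : E.Fiber x) :
    F.proj x *ᵥ (F.fiber x).coord v = (F.fiber x).coord v := by
  rw [proj_mulVec, (F.fiber x).synth_coord]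

theorem synth_proj (x : X) (y : ι → A) :
    (F.fiber x).synth (F.proj x *ᵥ y) = (F.fiber x).synth y := by
  rw [proj_mulVec, (F.fiber x).synth_coord]

/-- The matrix represents `T T⋆`, where `T` is the coordinate map and `T⋆ T = 1`. -/
theorem isStarProjection_proj (x : X) : IsStarProjection (F.proj x) := by
  constructor
  · refine matrix_ext_mulVec fun y => ?_
    rw [← Matrix.mulVec_mulVec, proj_mulVec, synth_proj, proj_mulVec]
  · have key : ∀ y z : ι → A, star y ⬝ᵥ (F.proj x *ᵥ z) = star (F.proj x *ᵥ y) ⬝ᵥ z := by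
      intro y z
      rw [proj_mulVec, proj_mulVec, ← (F.fiber x).inner_synth, Matrix.star_dotProduct,
        ← (F.fiber x).inner_synth, HilbertModule.star_inner]
    show (F.proj x)ᴴ = F.proj x
    ext i j
    have h := key (Pi.single i 1) (Pi.single j 1)
    rw [Matrix.star_mulVec, ← Matrix.dotProduct_mulVec] at h
    simpa [← Pi.single_star] using h.symm

theorem continuous_proj : Continuous F.proj :=
  continuous_matrix fun i j => (continuous_apply i).comp <| F.continuous_coord.comp <|
    F.continuous_synth.comp (continuous_id.prodMk (continuous_const (y := Pi.single j 1)))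

/-- The matrix of a map of sections. -/
def toMatrix {E' : HilbertBundle A X} (F' : Frame E' κ)
    (L : E.sections →ₗ[C(X, A)ᵐᵒᵖ] E'.sections) (x : X) : Matrix κ ι A :=
  (colMatrix (F'.sectCoord ∘ₗ L ∘ₗ F.sectSynth)).map fun f => f x

variable {E' : HilbertBundle A X} (F' : Frame E' κ) (L : E.sections →ₗ[C(X, A)ᵐᵒᵖ] E'.sections)

theorem continuous_toMatrix : Continuous (F.toMatrix F' L) :=
  continuous_matrix fun i j =>
    (colMatrix (F'.sectCoord ∘ₗ L ∘ₗ F.sectSynth) i j).continuous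

/-- Between section modules with frames, a linear map becomes a matrix over `C(X, A)`. It therefore
acts fiberwise, and its value at `x` depends only on the argument at `x`. -/
theorem toMatrix_mulVec (y : ι → C(X, A)) (x : X) :
    F.toMatrix F' L x *ᵥ (fun i => y i x) = (F'.fiber x).coord ((L (F.sectSynth y)).1 x) := by
  have h := colMatrix_mulVec (F'.sectCoord ∘ₗ L ∘ₗ F.sectSynth) y
  funext k
  have hk := DFunLike.congr_fun (congrFun h k) x
  rw [LinearMap.comp_apply, LinearMap.comp_apply, sectCoord_apply] at hk
  rw [← hk]
  simp [Matrix.mulVec, dotProduct, toMatrix]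

theorem toMatrix_mulVec_coord (s : E.sections) (x : X) :
    F.toMatrix F' L x *ᵥ (F.fiber x).coord (s.1 x) = (F'.fiber x).coord ((L s).1 x) := by
  have h := F.toMatrix_mulVec F' L (F.sectCoord s) x
  rwa [sectSynth_sectCoord] at h

/-- Every vector of `A ^ ι` is the value of a constant coefficient function, and synthesizing a
vector or its projection yields the same section. -/
theorem toMatrix_mul_proj (x : X) : F.toMatrix F' L x * F.proj x = F.toMatrix F' L x := by
  refine matrix_ext_mulVec fun y => ?_
  have h1 := F.toMatrix_mulVec F' L (fun i => .const X (y i)) x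
  have h2 := F.toMatrix_mulVec_coord F' L (F.sectSynth fun i => .const X (y i)) x
  rw [← Matrix.mulVec_mulVec, proj_mulVec]
  exact h2.trans h1.symm

theorem proj_mul_toMatrix [DecidableEq κ] (x : X) :
    F'.proj x * F.toMatrix F' L x = F.toMatrix F' L x := by
  refine matrix_ext_mulVec fun y => ?_
  have h1 := F.toMatrix_mulVec F' L (fun i => .const X (y i)) x
  simp only [ContinuousMap.const_apply] at h1
  rw [← Matrix.mulVec_mulVec, h1, proj_mulVec_coord]

theorem toMatrix_mul_toMatrix [DecidableEq κ] (L' : E'.sections →ₗ[C(X, A)ᵐᵒᵖ] E.sections)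
    (h : ∀ s, L' (L s) = s) (x : X) : F'.toMatrix F L' x * F.toMatrix F' L x = F.proj x := by
  refine matrix_ext_mulVec fun y => ?_
  have h1 := F.toMatrix_mulVec F' L (fun i => .const X (y i)) x
  simp only [ContinuousMap.const_apply] at h1
  rw [← Matrix.mulVec_mulVec, h1, toMatrix_mulVec_coord, h, proj_mulVec]
  rfl

end Frame

variable [StarOrderedRing A]

/-- A continuous family of partial isometries between the projections of two frames is an
isomorphism of the bundles. -/
theorem isIso_of_partialIsometry {E E' : HilbertBundle A X} {ι : Type*} [Fintype ι]
    [DecidableEq ι] (F : Frame E ι) (F' : Frame E' ι) {u : X → Matrix ι ι A} (hu : Continuous u)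
    (h : ∀ x, star (u x) * u x = F.proj x) (h' : ∀ x, u x * star (u x) = F'.proj x) :
    IsIso E E' := by
  -- Quantified over both bundles because it is used twice, for `u` and for `star u`, to get the two
  -- inverse laws.
  have inv : ∀ {E E' : HilbertBundle A X} (F : Frame E ι) (F' : Frame E' ι)
      {u : X → Matrix ι ι A} (_ : ∀ x, star (u x) * u x = F.proj x)
      (_ : ∀ x, u x * star (u x) = F'.proj x) (x : X) (v : E.Fiber x),
      (F.fiber x).synth (star (u x) *ᵥ (F'.fiber x).coord
        ((F'.fiber x).synth (u x *ᵥ (F.fiber x).coord v))) = v := by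
    intro E E' F F' u h h' x v
    rw [← F'.proj_mulVec, ← h', Matrix.mulVec_mulVec, Matrix.mulVec_mulVec,
      show star (u x) * (u x * star (u x)) * u x = F.proj x * F.proj x by rw [← h]; noncomm_ring,
      (F.isStarProjection_proj x).isIdempotentElem.eq, F.synth_proj, (F.fiber x).synth_coord]
  refine ⟨fun x => ⟨LinearEquiv.ofLinearMap
      ((F'.fiber x).synth ∘ₗ (u x).mulVecRight ∘ₗ (F.fiber x).coord)
      ((F.fiber x).synth ∘ₗ (star (u x)).mulVecRight ∘ₗ (F'.fiber x).coord) ?_ ?_, ?_⟩, ?_, ?_⟩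
  · refine LinearMap.ext fun v => ?_
    have := inv F' F (u := fun x => star (u x)) (by simpa using h') (by simpa using h) x v
    simp only [star_star] at this
    exact this
  · exact LinearMap.ext fun v => inv F F' h h' x v
  · intro v w
    have e : ∀ z : E.Fiber x, (F'.fiber x).coord
        ((F'.fiber x).synth (u x *ᵥ (F.fiber x).coord z)) = u x *ᵥ (F.fiber x).coord z := by
      intro z
      rw [← F'.proj_mulVec, ← h', Matrix.mulVec_mulVec, mul_assoc, h,
        ← Matrix.mulVec_mulVec, F.proj_mulVec_coord]
    show inner A ((F'.fiber x).synth (u x *ᵥ (F.fiber x).coord v))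
      ((F'.fiber x).synth (u x *ᵥ (F.fiber x).coord w)) = _
    rw [(F'.fiber x).inner_eq, e, e, Matrix.star_mulVec, ← Matrix.dotProduct_mulVec,
      Matrix.mulVec_mulVec, (F.fiber x).inner_eq]
    have := h x
    rw [Matrix.star_eq_conjTranspose] at this
    rw [this, F.proj_mulVec_coord]
  · have h1 : Continuous fun p : E.Total => u p.base *ᵥ (F.fiber p.base).coord p.vec :=
      (hu.comp E.continuous_base).matrix_mulVec F.continuous_coord
    exact F'.continuous_synth.comp (E.continuous_base.prodMk h1)
  · have h1 : Continuous fun p : E'.Total => star (u p.base) *ᵥ (F'.fiber p.base).coord p.vec :=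
      (hu.star.comp E'.continuous_base).matrix_mulVec F'.continuous_coord
    exact F.continuous_synth.comp (E'.continuous_base.prodMk h1)

/-- The matrix version of `exists_continuous_partialIsometry`. -/
theorem _root_.exists_continuous_matrix_partialIsometry {Y : Type*} [TopologicalSpace Y]
    {ι : Type*} [Fintype ι] [DecidableEq ι] {T P Q : Y → Matrix ι ι A}
    (hT : Continuous T) (hP : Continuous P)
    (hp : ∀ y, IsStarProjection (P y)) (hq : ∀ y, IsStarProjection (Q y))
    (htp : ∀ y, T y * P y = T y) (hqt : ∀ y, Q y * T y = T y)
    (hc : ∀ y, IsUnit (star (T y) * T y + (1 - P y)))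
    (hd : ∀ y, IsUnit (T y * star (T y) + (1 - Q y))) :
    ∃ U : Y → Matrix ι ι A, Continuous U ∧
      ∀ y, star (U y) * U y = P y ∧ U y * star (U y) = Q y :=
  -- `CStarMatrix` is the same star ring with a C⋆-norm inducing the entrywise topology, so
  -- continuity passes over unchanged.
  exists_continuous_partialIsometry (M := CStarMatrix ι ι A) hT hP
    (fun y => ⟨(hp y).isIdempotentElem, (hp y).isSelfAdjoint⟩)
    (fun y => ⟨(hq y).isIdempotentElem, (hq y).isSelfAdjoint⟩) htp hqt hc hd

/-- Bundles with frames and isomorphic modules of sections are isomorphic. -/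
theorem isIso_of_sectionsEquiv {E E' : HilbertBundle A X} {ι κ : Type*} [Fintype ι]
    [DecidableEq ι] [Fintype κ] [DecidableEq κ] (F₀ : Frame E ι) (F₀' : Frame E' κ)
    (L : E.sections ≃ₗ[C(X, A)ᵐᵒᵖ] E'.sections) : IsIso E E' := by
  -- Padding with zeros puts both frames in the same free module, so the transition matrices are
  -- square and live in one C⋆-algebra.
  let F : Frame E (ι ⊕ κ) := F₀.inl κ
  let F' : Frame E' (ι ⊕ κ) := (F₀'.inl ι).reindex (Equiv.sumComm κ ι)
  let t := F.toMatrix F' L.toLinearMap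
  let t' := F'.toMatrix F L.symm.toLinearMap
  have hp := F.isStarProjection_proj
  have hq := F'.isStarProjection_proj
  have htp : ∀ x, t x * F.proj x = t x := F.toMatrix_mul_proj F' _
  have hqt : ∀ x, F'.proj x * t x = t x := F.proj_mul_toMatrix F' _
  have htq' : ∀ x, t' x * F'.proj x = t' x := F'.toMatrix_mul_proj F _
  have hpt' : ∀ x, F.proj x * t' x = t' x := F'.proj_mul_toMatrix F _
  have h1 : ∀ x, t' x * t x = F.proj x := F.toMatrix_mul_toMatrix F' _ _ L.symm_apply_apply
  have h2 : ∀ x, t x * t' x = F'.proj x := F'.toMatrix_mul_toMatrix F _ _ L.apply_symm_apply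
  obtain ⟨u, hu, hu'⟩ := exists_continuous_matrix_partialIsometry (F.continuous_toMatrix F' _)
    F.continuous_proj hp hq htp hqt
    (fun x => isUnit_star_mul_self_add (hp x) (hq x) (htp x) (hqt x) (hpt' x) (h1 x) (h2 x))
    -- The second invertibility condition is the first one for the adjoints, with `p` and `q`
    -- exchanged.
    (fun x => by
      have := isUnit_star_mul_self_add (t := star (t x)) (t' := star (t' x)) (hq x) (hp x)
        (by rw [← (hq x).isSelfAdjoint.star_eq, ← star_mul, hqt])
        (by rw [← (hp x).isSelfAdjoint.star_eq, ← star_mul, htp])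
        (by rw [← (hq x).isSelfAdjoint.star_eq, ← star_mul, htq'])
        (by rw [← star_mul, h2, (hq x).isSelfAdjoint.star_eq])
        (by rw [← star_mul, h1, (hp x).isSelfAdjoint.star_eq])
      rwa [star_star] at this)
  exact isIso_of_partialIsometry F F' hu (fun x => (hu' x).1) fun x => (hu' x).2

end HilbertBundle

/-! ### The range of a projection in `Mₙ(A)` as a Hilbert module -/

section ProjModule

open scoped Matrix

/-- The right submodule of `A ^ ι` of vectors fixed by a matrix. -/
def fixedSubmodule {A : Type*} [Ring A] {ι : Type*} [Fintype ι] [DecidableEq ι]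
    (p : Matrix ι ι A) : Submodule Aᵐᵒᵖ (ι → A) :=
  LinearMap.eqLocus p.mulVecRight LinearMap.id

/-- The vectors fixed by a matrix, with the norm of a Hilbert module. -/
def ProjModule {A : Type*} [Ring A] {ι : Type*} [Fintype ι] [DecidableEq ι]
    (p : Matrix ι ι A) : Type _ := fixedSubmodule p

namespace ProjModule

variable {A : Type*} [CStarAlgebra A] [PartialOrder A] {ι : Type*}
  [Fintype ι] [DecidableEq ι] {p : Matrix ι ι A}

instance : AddCommGroup (ProjModule p) := inferInstanceAs (AddCommGroup (fixedSubmodule p))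
instance : Module Aᵐᵒᵖ (ProjModule p) := inferInstanceAs (Module Aᵐᵒᵖ (fixedSubmodule p))

variable (p) in
/-- The inclusion into `A ^ ι`. -/
def val : ProjModule p →ₗ[Aᵐᵒᵖ] (ι → A) := (fixedSubmodule p).subtype

theorem val_injective : Function.Injective (val p) := Subtype.val_injective

theorem mulVec_val (v : ProjModule p) : p *ᵥ val p v = val p v := v.2

/-- A fixed vector as an element of the module. -/
def mk (v : ι → A) (h : p *ᵥ v = v) : ProjModule p := ⟨v, h⟩

instance : Inner A (ProjModule p) := ⟨fun v w => star (val p v) ⬝ᵥ val p w⟩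

instance : Norm (ProjModule p) := ⟨fun v => √‖inner A v v‖⟩

theorem inner_def (v w : ProjModule p) : inner A v w = star (val p v) ⬝ᵥ val p w := rfl

theorem inner_add_right (v w₁ w₂ : ProjModule p) :
    inner A v (w₁ + w₂) = inner A v w₁ + inner A v w₂ := by
  simp only [inner_def, map_add, dotProduct_add]

theorem star_inner (v w : ProjModule p) : star (inner A v w) = inner A w v := by
  rw [inner_def, inner_def, Matrix.star_dotProduct, star_star]

theorem inner_op_smul_right (v w : ProjModule p) (a : A) :
    inner A v (op a • w) = inner A v w * a := by
  simp only [inner_def, map_smul, dotProduct, Finset.sum_mul]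
  exact Finset.sum_congr rfl fun i _ => by simp [mul_assoc]

variable [StarOrderedRing A]

theorem inner_self_nonneg (v : ProjModule p) : 0 ≤ inner A v v :=
  Finset.sum_nonneg fun i _ => star_mul_self_nonneg (val p v i)

theorem inner_self_eq_zero (v : ProjModule p) : inner A v v = 0 ↔ v = 0 := by
  show ∑ i, star (val p v i) * val p v i = 0 ↔ v = 0
  rw [Finset.sum_eq_zero_iff_of_nonneg
    (fun i _ => star_mul_self_nonneg (val p v i)), ← val_injective.eq_iff, map_zero, funext_iff]
  simp

/-- The triangle inequality is that of a `CStarModule` over the opposite algebra. The existential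
keeps the auxiliary complex structure from becoming an instance. -/
theorem exists_normCore : ∃ _ : Module ℂ (ProjModule p), NormedSpace.Core ℂ (ProjModule p) := by
  let : Module ℂ (ProjModule p) := Module.compHom _ (algebraMap ℂ Aᵐᵒᵖ)
  let : CStarModule Aᵐᵒᵖ (ProjModule p) :=
    { inner := fun v w => op (inner A v w)
      inner_add_right := fun {v w z} => by rw [← op_add, inner_add_right]
      inner_self_nonneg := fun {v} => inner_self_nonneg v
      inner_self := fun {v} => by rw [op_eq_zero_iff, inner_self_eq_zero]
      inner_op_smul_right := fun {a v w} => by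
        obtain ⟨a, rfl⟩ := op_surjective a
        rw [← op_mul]
        exact congrArg op (inner_op_smul_right _ _ _)
      inner_smul_right_complex := fun {z v w} => by
        rw [← op_smul]
        refine congrArg op ?_
        rw [show z • w = op (algebraMap ℂ A z) • w from rfl, inner_op_smul_right,
          ← Algebra.commutes, ← Algebra.smul_def]
      star_inner := fun v w => by rw [← op_star, star_inner]
      norm_eq_sqrt_norm_inner_self := fun v => rfl }
  exact ⟨inferInstance, CStarModule.normedSpaceCore Aᵐᵒᵖ⟩

instance : NormedAddCommGroup (ProjModule p) :=
  letI := (exists_normCore (p := p)).choose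
  NormedAddCommGroup.ofCore (exists_normCore (p := p)).choose_spec

theorem norm_def (v : ProjModule p) : ‖v‖ = √‖inner A v v‖ := rfl

theorem norm_val_le (v : ProjModule p) : ‖val p v‖ ≤ ‖v‖ := by
  refine (pi_norm_le_iff_of_nonneg (norm_nonneg _)).2 fun i => ?_
  refine Real.le_sqrt_of_sq_le ?_
  rw [sq, ← CStarRing.norm_star_mul_self]
  refine CStarAlgebra.norm_le_norm_of_nonneg_of_le (star_mul_self_nonneg _) ?_
  exact Finset.single_le_sum (f := fun i => star (val p v i) * val p v i)
    (fun i _ => star_mul_self_nonneg _) (Finset.mem_univ i)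

/-- With `norm_val_le`, this makes the Hilbert norm equivalent to the supremum norm, from which
completeness is inherited. -/
theorem norm_le (v : ProjModule p) : ‖v‖ ≤ √(Fintype.card ι) * ‖val p v‖ := by
  rw [norm_def]
  refine (Real.sqrt_le_left (by positivity)).2 ?_
  rw [mul_pow, Real.sq_sqrt (Nat.cast_nonneg _), ← nsmul_eq_mul, ← Finset.card_univ,
    ← Finset.sum_const]
  refine (norm_sum_le _ _).trans (Finset.sum_le_sum fun i _ => ?_)
  rw [Pi.star_apply, CStarRing.norm_star_mul_self, ← sq]
  gcongr
  exact norm_le_pi_norm _ i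

instance : HilbertModule A (ProjModule p) where
  inner_op_smul_right := inner_op_smul_right
  inner_add_left v₁ v₂ v₃ := by
    rw [← star_inner, inner_add_right, star_add, star_inner, star_inner]
  star_inner := star_inner
  inner_self_nonneg := inner_self_nonneg
  inner_self_eq_zero := inner_self_eq_zero
  norm_eq_sqrt := norm_def
  complete := by
    refine Metric.complete_of_cauchySeq_tendsto fun u hu => ?_
    have h1 : CauchySeq fun n => val p (u n) := by
      refine (LipschitzWith.uniformContinuous (K := 1) ?_).comp_cauchySeq hu
        (f := fun v : ProjModule p => val p v)
      exact LipschitzWith.of_dist_le_mul fun v w => by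
        rw [dist_eq_norm, dist_eq_norm, NNReal.coe_one, one_mul, ← map_sub]
        exact norm_val_le (v - w)
    obtain ⟨a, ha⟩ := cauchySeq_tendsto_of_complete h1
    -- The fixed vectors form a closed set, so the limit in `A ^ ι` is again fixed.
    have hpa : p *ᵥ a = a := by
      have hc : Continuous fun y : ι → A => p *ᵥ y :=
        continuous_const.matrix_mulVec continuous_id
      refine tendsto_nhds_unique ((hc.tendsto a).comp ha) ?_
      simpa only [Function.comp_def, mulVec_val] using ha
    refine ⟨mk a hpa, tendsto_iff_norm_sub_tendsto_zero.2 ?_⟩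
    have h2 : Filter.Tendsto (fun n => √(Fintype.card ι) * ‖val p (u n) - a‖) Filter.atTop
        (nhds 0) := by
      simpa using (tendsto_iff_norm_sub_tendsto_zero.1 ha).const_mul √(Fintype.card ι)
    exact squeeze_zero (fun n => norm_nonneg _) (fun n => norm_le (u n - mk a hpa)) h2

/-- The standard frame of the range of a projection. -/
def frame (hp : IsStarProjection p) : HilbertModule.Frame A (ProjModule p) ι where
  coord := val p
  synth := LinearMap.codRestrict (fixedSubmodule p) p.mulVecRight fun y => by
    show p *ᵥ (p *ᵥ y) = p *ᵥ y
    rw [Matrix.mulVec_mulVec, hp.isIdempotentElem.eq]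
  synth_coord v := val_injective (mulVec_val v)
  inner_synth v y := by
    show star (val p v) ⬝ᵥ (p *ᵥ y) = _
    have h : pᴴ = p := hp.isSelfAdjoint
    conv_rhs => rw [← mulVec_val v, Matrix.star_mulVec, h]
    rw [Matrix.dotProduct_mulVec]

/-- The inclusion has a continuous left inverse, the synthesis map of the standard frame. -/
theorem isInducing_val (hp : IsStarProjection p) : Topology.IsInducing (val p) :=
  Topology.IsInducing.of_comp (frame hp).continuous_coord (frame hp).continuous_synth <| by
    have : (frame hp).synth ∘ val p = id := funext (frame hp).synth_coord
    rw [this]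
    exact Topology.IsInducing.id

/-- Synthesis followed by coordinates is the orthogonal projection: evaluating `⟪w, synth y⟫` by
adjointness and by isometry gives the required orthogonality. -/
theorem isFGP {κ : Type*} [Fintype κ] (F : HilbertModule.Frame A (ProjModule p) κ) :
    HilbertModule.IsFGP A (ProjModule p) := by
  let e := Fintype.equivFin κ
  refine ⟨Fintype.card κ, LinearMap.funLeft Aᵐᵒᵖ A e.symm ∘ₗ F.coord, fun v w => ?_, fun y => ?_⟩
  · rw [F.inner_eq]
    exact Fintype.sum_equiv e.symm _ _ fun _ => rfl
  · refine ⟨F.synth (fun k => y (e k)), fun w => ?_⟩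
    have h : inner A w (F.synth (fun k => y (e k))) =
        star (F.coord w) ⬝ᵥ F.coord (F.synth (fun k => y (e k))) := F.inner_eq _ _
    rw [F.inner_synth, ← sub_eq_zero, ← dotProduct_sub] at h
    rw [← h]
    exact Fintype.sum_equiv e.symm _ _ fun i => by simp [LinearMap.funLeft]

/-- A partial isometry from `p` to `q` is an isomorphism between their ranges. -/
def iso {q u : Matrix ι ι A} (hu : star u * u = p) (hu' : u * star u = q) :
    HilbertModuleIso A (ProjModule p) (ProjModule q) where
  toLinearEquiv := LinearEquiv.ofLinearMap
    (LinearMap.codRestrict (fixedSubmodule q) (u.mulVecRight ∘ₗ val p) fun v => by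
      show q *ᵥ (u *ᵥ val p v) = u *ᵥ val p v
      rw [Matrix.mulVec_mulVec, ← hu', mul_assoc, hu, ← Matrix.mulVec_mulVec, mulVec_val])
    (LinearMap.codRestrict (fixedSubmodule p) ((star u).mulVecRight ∘ₗ val q) fun v => by
      show p *ᵥ (star u *ᵥ val q v) = star u *ᵥ val q v
      rw [Matrix.mulVec_mulVec, ← hu, mul_assoc, hu', ← Matrix.mulVec_mulVec, mulVec_val])
    (LinearMap.ext fun v => val_injective <| by
      show u *ᵥ (star u *ᵥ val q v) = val q v
      rw [Matrix.mulVec_mulVec, hu', mulVec_val])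
    (LinearMap.ext fun v => val_injective <| by
      show star u *ᵥ (u *ᵥ val p v) = val p v
      rw [Matrix.mulVec_mulVec, hu, mulVec_val])
  inner_map v w := by
    show star (u *ᵥ val p v) ⬝ᵥ (u *ᵥ val p w) = star (val p v) ⬝ᵥ val p w
    rw [Matrix.star_mulVec, ← Matrix.dotProduct_mulVec, Matrix.mulVec_mulVec,
      ← Matrix.star_eq_conjTranspose, hu, mulVec_val]

end ProjModule

end ProjModule

/-! ### The bundle defined by a projection-valued function -/

namespace HilbertBundle

open scoped Matrix

variable {A : Type v} [CStarAlgebra A] [PartialOrder A] [StarOrderedRing A] {X : Type u}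
  [TopologicalSpace X] {ι : Type u} [Fintype ι] [DecidableEq ι]

/-- The total space of the bundle of ranges is topologized as a subspace of `X × A ^ ι`. -/
abbrev projTopology (p : X → Matrix ι ι A) :
    TopologicalSpace (FamilyTotal fun x => ProjModule (p x)) :=
  .induced (fun q => (q.base, ProjModule.val (p q.base) q.vec)) inferInstance

/-- Units are open in the complete normed ring of matrices with its C⋆-norm. -/
theorem isOpen_isUnit_matrix :
    IsOpen {m : Matrix ι ι A | IsUnit m} :=
  Units.isOpen (R := CStarMatrix ι ι A)

/-- The bundle of ranges of a projection-valued function. -/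
def ofProj (p : X → Matrix ι ι A) (hc : Continuous p) (hp : ∀ x, IsStarProjection (p x)) :
    HilbertBundle A X :=
  letI := projTopology p
  { Fiber := fun x => ProjModule (p x)
    continuous_base := continuous_fst.comp (continuous_induced_dom (f := fun q :
      FamilyTotal fun x => ProjModule (p x) => (q.base, ProjModule.val (p q.base) q.vec)))
    exists_trivialization := fun x₀ => by
      have hd : Continuous fun q : FamilyTotal fun x => ProjModule (p x) =>
          (q.base, ProjModule.val (p q.base) q.vec) := continuous_induced_dom
      -- Compressing `p x` to `p x₀` gives a map between the ranges. Its polar part trivializes the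
      -- bundle wherever `c` and `d` are invertible, and both equal `1` at `x₀`.
      let T : X → Matrix ι ι A := fun x => p x₀ * p x
      let c : X → Matrix ι ι A := fun x => star (T x) * T x + (1 - p x)
      let d : X → Matrix ι ι A := fun x => T x * star (T x) + (1 - p x₀)
      have hT : Continuous T := continuous_const.matrix_mul hc
      have hcc : Continuous c :=
        (hT.star.matrix_mul hT).add (continuous_const.sub hc)
      have hdc : Continuous d := (hT.matrix_mul hT.star).add continuous_const
      have h0 : T x₀ = p x₀ := (hp x₀).isIdempotentElem
      have hs0 : star (p x₀) = p x₀ := (hp x₀).isSelfAdjoint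
      have hU := (isOpen_isUnit_matrix.preimage hcc).inter (isOpen_isUnit_matrix.preimage hdc)
      have hx : x₀ ∈ c ⁻¹' {m | IsUnit m} ∩ d ⁻¹' {m | IsUnit m} := by
        have h1 : c x₀ = 1 := by
          simp only [c, h0, hs0, (hp x₀).isIdempotentElem.eq]; abel
        have h2 : d x₀ = 1 := by
          simp only [d, h0, hs0, (hp x₀).isIdempotentElem.eq]; abel
        exact ⟨by simp [h1], by simp [h2]⟩
      obtain ⟨w, hw, hw'⟩ := exists_continuous_matrix_partialIsometry
        (Y := (c ⁻¹' {m | IsUnit m} ∩ d ⁻¹' {m | IsUnit m} : Set X)) (T := fun y => T y)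
        (P := fun y => p y) (Q := fun _ => p x₀) (hT.comp continuous_subtype_val)
        (hc.comp continuous_subtype_val) (fun y => hp y) (fun _ => hp x₀)
        (fun y => by show p x₀ * p y * p y = _; rw [mul_assoc, (hp y).isIdempotentElem.eq])
        (fun y => by
          show p x₀ * (p x₀ * p y) = _; rw [← mul_assoc, (hp x₀).isIdempotentElem.eq])
        (fun y => y.2.1) (fun y => y.2.2)
      refine ⟨_, hU, hx, ProjModule (p x₀), inferInstance, inferInstance, inferInstance,
        fun x => ProjModule.iso (hw' x).1 (hw' x).2, ?_, ?_⟩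
      · have hb : Continuous fun q : {q : FamilyTotal fun x => ProjModule (p x) //
            q.base ∈ c ⁻¹' {m | IsUnit m} ∩ d ⁻¹' {m | IsUnit m}} =>
            (⟨q.1.base, q.2⟩ : (c ⁻¹' {m | IsUnit m} ∩ d ⁻¹' {m | IsUnit m} : Set X)) :=
          (continuous_fst.comp (hd.comp continuous_subtype_val)).subtype_mk _
        refine hb.prodMk ((ProjModule.isInducing_val (hp x₀)).continuous_iff.2 ?_)
        exact (hw.comp hb).matrix_mulVec (continuous_snd.comp (hd.comp continuous_subtype_val))
      · refine Continuous.subtype_mk (continuous_induced_rng.2 ?_) _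
        refine (continuous_subtype_val.comp continuous_fst).prodMk ?_
        exact (hw.comp continuous_fst).star.matrix_mulVec
          ((ProjModule.frame (hp x₀)).continuous_coord.comp continuous_snd) }

/-- The standard frame of the bundle of ranges. -/
def ofProjFrame {p : X → Matrix ι ι A} (hc : Continuous p) (hp : ∀ x, IsStarProjection (p x)) :
    Frame (ofProj p hc hp) ι where
  fiber x := ProjModule.frame (hp x)
  continuous_coord :=
    letI := projTopology p
    continuous_snd.comp (continuous_induced_dom (f := fun q :
      FamilyTotal fun x => ProjModule (p x) => (q.base, ProjModule.val (p q.base) q.vec)))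
  continuous_synth :=
    letI := projTopology p
    continuous_induced_rng.2 (continuous_fst.prodMk
      ((hc.comp continuous_fst).matrix_mulVec continuous_snd))

/-- The finitely generated projective bundle of ranges. -/
def _root_.FGPBundle.ofProj (p : X → Matrix ι ι A) (hc : Continuous p)
    (hp : ∀ x, IsStarProjection (p x)) : FGPBundle A X :=
  ⟨HilbertBundle.ofProj p hc hp, fun x => ProjModule.isFGP (ProjModule.frame (hp x))⟩

/-- A module which is a retract of `C(X, A) ^ κ` is isomorphic to the module of sections of a
bundle. -/
theorem exists_sectionsEquiv_of_retract {P : Type*} [AddCommGroup P] [Module C(X, A)ᵐᵒᵖ P]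
    (i : P →ₗ[C(X, A)ᵐᵒᵖ] (ι → C(X, A))) (r : (ι → C(X, A)) →ₗ[C(X, A)ᵐᵒᵖ] P)
    (hri : ∀ m, r (i m) = m) :
    ∃ E : FGPBundle A X, Nonempty (P ≃ₗ[C(X, A)ᵐᵒᵖ] E.toHilbertBundle.sections) := by
  -- The retraction is encoded by an idempotent matrix over `C(X, A)`, whose values `e x` need not
  -- be self-adjoint.
  let m := colMatrix (i ∘ₗ r)
  have hmi : ∀ y, m *ᵥ y = i (r y) := fun y => colMatrix_mulVec (i ∘ₗ r) y
  have hm : m * m = m := matrix_ext_mulVec fun y => by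
    rw [← Matrix.mulVec_mulVec, hmi, hmi, hri]
  let ev : X → C(X, A) →+* A := fun x =>
    ⟨⟨⟨fun f => f x, rfl⟩, fun _ _ => rfl⟩, rfl, fun _ _ => rfl⟩
  let e : X → Matrix ι ι A := fun x => m.map (ev x)
  have he : ∀ x, e x * e x = e x := fun x => by rw [← Matrix.map_mul, hm]
  have hec : Continuous e := continuous_matrix fun k l => (m k l).continuous
  have hev : ∀ (y : ι → C(X, A)) (x : X), e x *ᵥ (fun k => y k x) = fun k => i (r y) k x := by
    intro y x
    funext k
    rw [← hmi]
    simp only [Matrix.mulVec, dotProduct, ContinuousMap.coe_sum, Finset.sum_apply,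
      ContinuousMap.coe_mul, Pi.mul_apply]
    rfl
  obtain ⟨p, hpc, hp⟩ : ∃ p : X → Matrix ι ι A, Continuous p ∧
      ∀ x, IsStarProjection (p x) ∧ e x * p x = p x ∧ p x * e x = e x := by
    obtain ⟨p, hpc, hp⟩ := exists_continuous_starProjection (M := CStarMatrix ι ι A) hec he
    exact ⟨p, hpc, fun x => ⟨⟨(hp x).1.isIdempotentElem, (hp x).1.isSelfAdjoint⟩, (hp x).2⟩⟩
  have hp' : ∀ x, IsStarProjection (p x) := fun x => (hp x).1
  let F := ofProjFrame hpc hp'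
  refine ⟨FGPBundle.ofProj p hpc hp',
    ⟨LinearEquiv.ofLinearMap (F.sectSynth ∘ₗ i) (r ∘ₗ F.sectCoord) ?_ ?_⟩⟩
  · refine LinearMap.ext fun s => Subtype.ext <| funext fun x => ?_
    refine ProjModule.val_injective ?_
    show p x *ᵥ (fun k => (i (r (F.sectCoord s))) k x) = ProjModule.val (p x) (s.1 x)
    rw [← hev, Matrix.mulVec_mulVec, (hp x).2.2]
    -- From `e p = p`, the idempotent fixes the range of the projection; `p e = e` serves for the
    -- other inverse law.
    have h1 : ∀ v : ProjModule (p x), e x *ᵥ ProjModule.val (p x) v = ProjModule.val (p x) v := by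
      intro v
      rw [← ProjModule.mulVec_val, Matrix.mulVec_mulVec, (hp x).2.1]
    exact h1 (s.1 x)
  · refine LinearMap.ext fun z => ?_
    have h1 : F.sectCoord (F.sectSynth (i z)) = i z := by
      funext k
      ext x
      show (p x *ᵥ fun k => i z k x) k = i z k x
      have h2 : e x *ᵥ (fun k => i z k x) = fun k => i z k x := by rw [hev, hri]
      rw [← h2, Matrix.mulVec_mulVec, (hp x).2.2, h2]
    show r (F.sectCoord (F.sectSynth (i z))) = z
    rw [h1, hri]

/-- Every finitely generated projective module is isomorphic to the module of sections of a
bundle. -/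
theorem exists_sectionsEquiv (P : Type*) [AddCommGroup P] [Module C(X, A)ᵐᵒᵖ P]
    [Module.Finite C(X, A)ᵐᵒᵖ P] [Module.Projective C(X, A)ᵐᵒᵖ P] :
    ∃ E : FGPBundle A X, Nonempty (P ≃ₗ[C(X, A)ᵐᵒᵖ] E.toHilbertBundle.sections) := by
  obtain ⟨n, f, hf⟩ := Module.Finite.exists_fin' C(X, A)ᵐᵒᵖ P
  obtain ⟨g, hg⟩ := Module.projective_lifting_property f LinearMap.id hf
  -- The lift only adjusts the universe, so that the ranges are admissible as fibers.
  let σ : (ULift.{u} (Fin n) → C(X, A)) ≃ₗ[C(X, A)ᵐᵒᵖ] (Fin n → C(X, A)ᵐᵒᵖ) :=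
    (LinearEquiv.funCongrLeft C(X, A)ᵐᵒᵖ C(X, A) Equiv.ulift.symm).trans
      (LinearEquiv.piCongrRight fun _ => opSelfEquiv C(X, A))
  exact exists_sectionsEquiv_of_retract (σ.symm.toLinearMap ∘ₗ g) (f ∘ₗ σ.toLinearMap) fun m => by
    simpa using DFunLike.congr_fun hg m

end HilbertBundle

/-! ### The isomorphism of K-groups -/

namespace HilbertBundle

variable {A : Type v} [CStarAlgebra A] [PartialOrder A] {X : Type u} [TopologicalSpace X]

/-- Isomorphic bundles have isomorphic modules of sections. -/
theorem IsIso.nonempty_sectionsEquiv {E F : HilbertBundle A X} (h : IsIso E F) :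
    Nonempty (E.sections ≃ₗ[C(X, A)ᵐᵒᵖ] F.sections) := by
  obtain ⟨φ, h, h'⟩ := h
  exact ⟨
    { toFun := fun s => ⟨fun x => (φ x).toLinearEquiv (s.1 x), h.comp s.2⟩
      invFun := fun s => ⟨fun x => (φ x).toLinearEquiv.symm (s.1 x), h'.comp s.2⟩
      map_add' := fun s t => Subtype.ext <| funext fun x => map_add (φ x).toLinearEquiv _ _
      map_smul' := fun f s => Subtype.ext <| funext fun x => map_smul (φ x).toLinearEquiv _ _
      left_inv := fun s => Subtype.ext <| funext fun x =>
        (φ x).toLinearEquiv.symm_apply_apply _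
      right_inv := fun s => Subtype.ext <| funext fun x =>
        (φ x).toLinearEquiv.apply_symm_apply _ }⟩

/-- The sections of a direct sum are pairs of sections. -/
def sectionsSumEquiv [StarOrderedRing A] (E F : HilbertBundle A X) :
    (sum E F).sections ≃ₗ[C(X, A)ᵐᵒᵖ] E.sections × F.sections where
  toFun s := (⟨fun x => HilbertSum.fstHom (A := A) (s.1 x), continuous_sum_fst.comp s.2⟩,
    ⟨fun x => HilbertSum.sndHom (A := A) (s.1 x), continuous_sum_snd.comp s.2⟩)
  invFun q := ⟨fun x => HilbertSum.mkHom (A := A) (q.1.1 x, q.2.1 x),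
    continuous_sum_rng q.1.2 q.2.2⟩
  map_add' _ _ := rfl
  map_smul' _ _ := rfl
  left_inv _ := rfl
  right_inv _ := rfl

end HilbertBundle

section KTheory

variable {A : Type v} [CStarAlgebra A] [PartialOrder A] [StarOrderedRing A] {X : Type u}
  [TopologicalSpace X] [CompactSpace X] [T2Space X]

theorem FGPBundle.finite_sections (E : FGPBundle A X) :
    Module.Finite C(X, A)ᵐᵒᵖ E.toHilbertBundle.sections := by
  obtain ⟨ι, _, _, ⟨F⟩⟩ := E.exists_frame
  exact F.finite_sections

theorem FGPBundle.projective_sections (E : FGPBundle A X) :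
    Module.Projective C(X, A)ᵐᵒᵖ E.toHilbertBundle.sections := by
  obtain ⟨ι, _, _, ⟨F⟩⟩ := E.exists_frame
  exact F.projective_sections

/-- The module of sections of a finitely generated projective bundle. -/
def FGPBundle.sectionsModule (E : FGPBundle A X) : FGPModule C(X, A) :=
  ⟨E.toHilbertBundle.sections, E.finite_sections, E.projective_sections⟩

variable (A X)

/-- The isomorphism class of the module of sections, as a function of the isomorphism class of the
bundle. -/
def sectionsClass : BundleClass A X → ModuleClass C(X, A) :=
  Quotient.map FGPBundle.sectionsModule fun _ _ h => h.nonempty_sectionsEquiv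

theorem sectionsClass_add (a b : BundleClass A X) :
    sectionsClass A X (a + b) = sectionsClass A X a + sectionsClass A X b := by
  induction a, b using Quotient.inductionOn₂ with
  | h E F =>
    exact Quotient.sound (show Nonempty _ from
      ⟨HilbertBundle.sectionsSumEquiv E.toHilbertBundle F.toHilbertBundle⟩)

/-- Injectivity is the polar decomposition argument, surjectivity the construction from idempotents.
No stabilization is needed. -/
theorem sectionsClass_bijective : Function.Bijective (sectionsClass A X) := by
  constructor
  · intro a b h
    induction a, b using Quotient.inductionOn₂ with
    | h E F =>
      obtain ⟨L⟩ := Quotient.exact h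
      obtain ⟨ι, _, _, ⟨FE⟩⟩ := E.exists_frame
      obtain ⟨κ, _, _, ⟨FF⟩⟩ := F.exists_frame
      exact Quotient.sound (HilbertBundle.isIso_of_sectionsEquiv FE FF L)
  · intro b
    induction b using Quotient.inductionOn with
    | h P =>
      obtain ⟨E, ⟨L⟩⟩ := HilbertBundle.exists_sectionsEquiv (A := A) (X := X) P.carrier
      exact ⟨Quotient.mk _ E, Quotient.sound ⟨L.symm⟩⟩

theorem exists_bundleK_equiv : ∃ s : BundleK A X ≃+ KZero C(X, A),
    ∀ E : FGPBundle A X, s E.toK = E.sectionsModule.toK := by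
  obtain ⟨s, hs⟩ := exists_grothendieckAddGroup_equiv
    (⟨Equiv.ofBijective _ (sectionsClass_bijective A X), sectionsClass_add A X⟩ :
      BundleClass A X ≃+ ModuleClass C(X, A))
  exact ⟨s, fun E => hs _⟩

end KTheory

/-! ### The tensor product `C(X) ⊗ A` -/

section Tensor

variable {X : Type u} [TopologicalSpace X] [CompactSpace X]
  {A : Type v} [CStarAlgebra A]

variable (X A) in
/-- Scalar functions as functions with values in `A`. -/
def scalarFun : C(X, ℂ) →ₐ[ℂ] C(X, A) :=
  AlgHom.ofLinearMap
    { toFun := fun f => (⟨fun x => f x • (1 : A), by fun_prop⟩ : C(X, A))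
      map_add' := fun f g => by ext x; simp [add_smul]
      map_smul' := fun c f => by ext x; exact mul_smul c (f x) (1 : A) }
    (by ext x; simp) (fun f g => by ext x; simp [smul_smul, mul_comm])

variable (X A) in
/-- Elements of `A` as constant functions. -/
def constFun : A →ₐ[ℂ] C(X, A) :=
  AlgHom.ofLinearMap
    { toFun := fun a => ContinuousMap.const X a
      map_add' := fun _ _ => rfl
      map_smul' := fun _ _ => rfl }
    rfl (fun _ _ => rfl)

theorem scalarFun_mul_constFun (f : C(X, ℂ)) (a : A) (x : X) :
    (scalarFun X A f * constFun X A a) x = f x • a := by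
  show (f x • (1 : A)) * a = _
  rw [smul_mul_assoc, one_mul]

theorem commute_scalarFun_constFun (f : C(X, ℂ)) (a : A) :
    Commute (scalarFun X A f) (constFun X A a) := by
  refine ContinuousMap.ext fun x => ?_
  rw [scalarFun_mul_constFun]
  show _ = a * (f x • (1 : A))
  rw [mul_smul_comm, mul_one]

variable (X A) in
/-- The canonical map `C(X) ⊗ A → C(X, A)`. -/
def tensorToFun : C(X, ℂ) ⊗[ℂ] A →⋆ₐ[ℂ] C(X, A) where
  toAlgHom := Algebra.TensorProduct.lift (scalarFun X A) (constFun X A) commute_scalarFun_constFun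
  map_star' t := by
    show Algebra.TensorProduct.lift (scalarFun X A) (constFun X A) commute_scalarFun_constFun _ =
      star (Algebra.TensorProduct.lift (scalarFun X A) (constFun X A)
        commute_scalarFun_constFun t)
    induction t using TensorProduct.induction_on with
    | zero => rw [star_zero, map_zero, star_zero]
    | tmul f a =>
      ext x
      rw [TensorProduct.star_tmul, Algebra.TensorProduct.lift_tmul, ContinuousMap.star_apply,
        Algebra.TensorProduct.lift_tmul, scalarFun_mul_constFun, scalarFun_mul_constFun,
        star_smul]
      rfl
    | add s t hs ht => rw [star_add, map_add, map_add, star_add, hs, ht]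

theorem tensorToFun_tmul (f : C(X, ℂ)) (a : A) (x : X) :
    tensorToFun X A (f ⊗ₜ a) x = f x • a := by
  show Algebra.TensorProduct.lift (scalarFun X A) (constFun X A) commute_scalarFun_constFun
    (f ⊗ₜ a) x = _
  rw [Algebra.TensorProduct.lift_tmul, scalarFun_mul_constFun]

/-- A real function as a complex function. -/
def ofRealFun (f : C(X, ℝ)) : C(X, ℂ) := ⟨fun x => (f x : ℂ), by fun_prop⟩

theorem ofRealFun_apply (f : C(X, ℝ)) (x : X) : ofRealFun f x = (f x : ℂ) := rfl

/-- As the weights sum to one, the difference is a convex combination of the `g x - g (c i)`; terms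
of weight zero need no control. -/
theorem norm_sub_sum_partition_le {E : Type*} [NormedAddCommGroup E] [NormedSpace ℂ E]
    {n : ℕ} {c : Fin n → X} {f : Fin n → C(X, ℝ)} (hsum : ∀ x, ∑ i, f i x = 1)
    (hpos : ∀ i x, 0 ≤ f i x) (g : X → E) {ε : ℝ}
    (h : ∀ i x, f i x ≠ 0 → ‖g x - g (c i)‖ ≤ ε) (x : X) :
    ‖g x - ∑ i, (f i x : ℂ) • g (c i)‖ ≤ ε := by
  have h1 : g x - ∑ i, (f i x : ℂ) • g (c i) = ∑ i, (f i x : ℂ) • (g x - g (c i)) := by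
    have h2 : ∑ i, (f i x : ℂ) = 1 := by exact_mod_cast hsum x
    simp only [smul_sub, Finset.sum_sub_distrib]
    rw [← Finset.sum_smul, h2, one_smul]
  rw [h1]
  calc ‖∑ i, (f i x : ℂ) • (g x - g (c i))‖ ≤ ∑ i, f i x * ε := by
        refine (norm_sum_le _ _).trans (Finset.sum_le_sum fun i _ => ?_)
        rw [norm_smul, Complex.norm_real, Real.norm_of_nonneg (hpos i x)]
        by_cases h0 : f i x = 0
        · simp [h0]
        · exact mul_le_mul_of_nonneg_left (h i x h0) (hpos i x)
    _ = ε := by rw [← Finset.sum_mul, hsum, one_mul]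

variable (X A) in
theorem denseRange_tensorToFun [T2Space X] : DenseRange (tensorToFun X A) := by
  refine fun g => Metric.mem_closure_range_iff.2 fun ε hε => ?_
  obtain ⟨n, c, f, hf, hsum, hpos⟩ := exists_finite_partition_of_unity
    (fun x => {y | ‖g y - g x‖ < ε / 2})
    (fun x => isOpen_lt (by fun_prop) continuous_const) (fun x => by simpa using half_pos hε)
  refine ⟨∑ i, ofRealFun (f i) ⊗ₜ g (c i), ?_⟩
  refine lt_of_le_of_lt ?_ (half_lt_self hε)
  refine (ContinuousMap.dist_le (half_pos hε).le).2 fun x => ?_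
  rw [dist_eq_norm]
  have := norm_sub_sum_partition_le hsum hpos g (ε := ε / 2)
    (fun i x hx => (hf i (subset_tsupport _ hx)).le) x
  simpa [tensorToFun_tmul, ofRealFun_apply] using this

-- Expand `t` over a basis of `A`: at each point the coefficients vanish by linear independence.
variable (X A) in
theorem injective_tensorToFun : Function.Injective (tensorToFun X A) := by
  classical
  rw [injective_iff_map_eq_zero]
  intro t ht
  let b := Module.Basis.ofVectorSpace ℂ A
  obtain ⟨f, rfl⟩ := (TensorProduct.equivFinsuppOfBasisRight (M := C(X, ℂ)) b).symm.surjective t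
  suffices f = 0 by rw [this, map_zero]
  rw [TensorProduct.equivFinsuppOfBasisRight_symm_apply] at ht
  ext i x
  have hx := DFunLike.congr_fun ht x
  have e : ∑ k ∈ f.support, (f k x) • b k = 0 := by
    simpa [Finsupp.sum, tensorToFun_tmul] using hx
  by_cases hi : i ∈ f.support
  · exact linearIndependent_iff'.1 b.linearIndependent _ _ e i hi
  · simp [Finsupp.notMem_support_iff.1 hi]

variable {B : Type w} [CStarAlgebra B] (j : C(X, ℂ) ⊗[ℂ] A →⋆ₐ[ℂ] B)

/-- Restricted to either factor, `j` is a star homomorphism of C⋆-algebras, hence contractive. -/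
theorem norm_map_tmul_le (f : C(X, ℂ)) (a : A) : ‖j (f ⊗ₜ a)‖ ≤ ‖f‖ * ‖a‖ := by
  let j₁ : C(X, ℂ) →⋆ₐ[ℂ] B :=
    { j.toAlgHom.comp Algebra.TensorProduct.includeLeft with
      map_star' := fun f => by
        show j (star f ⊗ₜ 1) = star (j (f ⊗ₜ 1))
        rw [← map_star, TensorProduct.star_tmul, star_one] }
  let j₂ : A →⋆ₐ[ℂ] B :=
    { j.toAlgHom.comp Algebra.TensorProduct.includeRight with
      map_star' := fun a => by
        show j (1 ⊗ₜ star a) = star (j (1 ⊗ₜ a))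
        rw [← map_star, TensorProduct.star_tmul, star_one] }
  have h : j (f ⊗ₜ a) = j₁ f * j₂ a := by
    show _ = j (f ⊗ₜ 1) * j (1 ⊗ₜ a)
    rw [← map_mul, Algebra.TensorProduct.tmul_mul_tmul, mul_one, one_mul]
  rw [h]
  refine (norm_mul_le _ _).trans ?_
  gcongr <;> exact NonUnitalStarAlgHom.norm_apply_le _ _

/-- Approximation by means of a partition of unity. -/
theorem exists_partition_norm_map_sub_le [T2Space X] (t : C(X, ℂ) ⊗[ℂ] A) {ε : ℝ} (hε : 0 < ε) :
    ∃ (n : ℕ) (c : Fin n → X) (f : Fin n → C(X, ℝ)), (∀ x, ∑ i, f i x = 1) ∧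
      (∀ i x, 0 ≤ f i x) ∧
      ‖j t - ∑ i, j (ofRealFun (f i) ⊗ₜ tensorToFun X A t (c i))‖ ≤ ε := by
  obtain ⟨m, g, a, rfl⟩ : ∃ (m : ℕ) (g : Fin m → C(X, ℂ)) (a : Fin m → A),
      t = ∑ k, g k ⊗ₜ a k := by
    obtain ⟨m, g, a, h⟩ := TensorProduct.exists_sum_tmul_eq t
    exact ⟨m, g, a, h⟩
  -- Chosen so that `δ * ∑ k, ‖a k‖ ≤ ε`; the summand `1` avoids division by zero.
  let δ := ε / (1 + ∑ k, ‖a k‖)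
  have h0 : 0 ≤ ∑ k, ‖a k‖ := Finset.sum_nonneg fun k _ => norm_nonneg _
  have hδ : 0 < δ := by positivity
  obtain ⟨n, c, f, hf, hsum, hpos⟩ := exists_finite_partition_of_unity
    (fun x => {y | ∀ k, ‖g k y - g k x‖ < δ})
    (fun x => by
      simp only [Set.ofPred_forall]
      exact isOpen_iInter_of_finite fun k => isOpen_lt (by fun_prop) continuous_const)
    (fun x k => by simpa using hδ)
  refine ⟨n, c, f, hsum, hpos, ?_⟩
  -- Only the scalar factors are approximated, so the estimate for elementary tensors suffices.
  have e : ∑ k, g k ⊗ₜ[ℂ] a k - ∑ i, ofRealFun (f i) ⊗ₜ[ℂ]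
      tensorToFun X A (∑ k, g k ⊗ₜ a k) (c i) =
      ∑ k, (g k - ∑ i, g k (c i) • ofRealFun (f i)) ⊗ₜ[ℂ] a k := by
    simp only [TensorProduct.sub_tmul, TensorProduct.sum_tmul, Finset.sum_sub_distrib, map_sum,
      ContinuousMap.coe_sum, Finset.sum_apply, tensorToFun_tmul, TensorProduct.tmul_sum]
    rw [Finset.sum_comm]
    simp only [TensorProduct.smul_tmul]
  rw [← map_sum, ← map_sub, e, map_sum]
  calc _ ≤ ∑ k, δ * ‖a k‖ := by
        refine (norm_sum_le _ _).trans (Finset.sum_le_sum fun k _ => ?_)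
        refine (norm_map_tmul_le j _ _).trans ?_
        gcongr
        refine (ContinuousMap.norm_le _ hδ.le).2 fun x => ?_
        have := norm_sub_sum_partition_le hsum hpos (g k) (ε := δ)
          (fun i x hx => (hf i (subset_tsupport _ hx) k).le) x
        simpa [ofRealFun_apply, mul_comm] using this
    _ ≤ ε := by
        rw [← Finset.mul_sum, div_mul_eq_mul_div, div_le_iff₀ (by positivity)]
        nlinarith

/-- The image of a positive elementary tensor is positive. -/
theorem map_tmul_nonneg [PartialOrder A] [StarOrderedRing A] [PartialOrder B] [StarOrderedRing B]
    {f : C(X, ℝ)} (hf : ∀ x, 0 ≤ f x) {a : A} (ha : 0 ≤ a) : 0 ≤ j (ofRealFun f ⊗ₜ a) := by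
  obtain ⟨b, rfl⟩ := CStarAlgebra.nonneg_iff_eq_star_mul_self.1 ha
  let g : C(X, ℝ) := ⟨fun x => √(f x), by fun_prop⟩
  have h : ofRealFun f = star (ofRealFun g) * ofRealFun g := by
    ext x
    simp only [ContinuousMap.mul_apply, ContinuousMap.star_apply, ofRealFun_apply, g,
      ContinuousMap.coe_mk, Complex.star_def, Complex.conj_ofReal]
    rw [← Complex.ofReal_mul, Real.mul_self_sqrt (hf x)]
  rw [h, ← Algebra.TensorProduct.tmul_mul_tmul, ← TensorProduct.star_tmul, map_mul, map_star]
  exact star_mul_self_nonneg _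

/-- The norm of `C(X, A)` dominates every C⋆-seminorm on `C(X) ⊗ A`. -/
theorem norm_map_le_norm_tensorToFun [T2Space X] (t : C(X, ℂ) ⊗[ℂ] A) :
    ‖j t‖ ≤ ‖tensorToFun X A t‖ := by
  let := CStarAlgebra.spectralOrder A
  have := CStarAlgebra.spectralOrderedRing A
  let := CStarAlgebra.spectralOrder B
  have := CStarAlgebra.spectralOrderedRing B
  -- The C⋆-identity reduces the claim to a positive element, for which norm bounds are order
  -- bounds.
  let s := star t * t
  set M := ‖tensorToFun X A t‖ with hM
  suffices ‖j s‖ ≤ M ^ 2 by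
    rw [map_mul, map_star, CStarRing.norm_star_mul_self, ← sq] at this
    exact (sq_le_sq₀ (norm_nonneg _) (norm_nonneg _)).1 this
  have hs : ∀ x, tensorToFun X A s x = star (tensorToFun X A t x) * tensorToFun X A t x :=
    fun x => by simp [s, map_mul, map_star]
  have hs0 : ∀ x, 0 ≤ tensorToFun X A s x := fun x => by rw [hs]; exact star_mul_self_nonneg _
  have hs1 : ∀ x, tensorToFun X A s x ≤ algebraMap ℝ A (M ^ 2) := fun x => by
    refine (CStarAlgebra.norm_le_iff_le_algebraMap _ (sq_nonneg M) (hs0 x)).1 ?_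
    rw [hs, CStarRing.norm_star_mul_self, ← sq]
    gcongr
    exact ContinuousMap.norm_coe_le_norm _ x
  refine le_of_forall_pos_le_add fun ε hε => ?_
  obtain ⟨n, c, f, hsum, hpos, h⟩ := exists_partition_norm_map_sub_le j s hε
  -- Positivity of the `f i` turns `0 ≤ s (c i) ≤ M²` into `0 ≤ r ≤ M²`, and `r` is within `ε` of `j
  -- s`.
  set r := ∑ i, j (ofRealFun (f i) ⊗ₜ tensorToFun X A s (c i)) with hr
  have hr0 : 0 ≤ r := Finset.sum_nonneg fun i _ => map_tmul_nonneg j (hpos i) (hs0 _)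
  have hr1 : r ≤ algebraMap ℝ B (M ^ 2) := by
    have e : algebraMap ℝ B (M ^ 2) = ∑ i, j (ofRealFun (f i) ⊗ₜ algebraMap ℝ A (M ^ 2)) := by
      rw [← map_sum, ← TensorProduct.sum_tmul]
      have h1 : ∑ i, ofRealFun (f i) = 1 := by
        ext x
        simp only [ContinuousMap.coe_sum, Finset.sum_apply, ofRealFun_apply,
          ContinuousMap.one_apply]
        exact_mod_cast hsum x
      rw [h1, Algebra.algebraMap_eq_smul_one, Algebra.algebraMap_eq_smul_one,
        ← Complex.coe_smul, ← Complex.coe_smul, TensorProduct.tmul_smul, map_smul,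
        ← Algebra.TensorProduct.one_def]
      exact congrArg _ j.toAlgHom.map_one.symm
    rw [e]
    refine Finset.sum_le_sum fun i _ => ?_
    rw [← sub_nonneg, ← map_sub, ← TensorProduct.tmul_sub]
    exact map_tmul_nonneg j (hpos i) (sub_nonneg.2 (hs1 _))
  have hr2 : ‖r‖ ≤ M ^ 2 := (CStarAlgebra.norm_le_iff_le_algebraMap _ (sq_nonneg M) hr0).2 hr1
  calc ‖j s‖ = ‖r + (j s - r)‖ := by rw [add_sub_cancel]
    _ ≤ ‖r‖ + ‖j s - r‖ := norm_add_le _ _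
    _ ≤ M ^ 2 + ε := add_le_add hr2 h

end Tensor

/-! ### Uniqueness of the C⋆-norm -/

section Injective

/-- A bump function at `0` of width `ε`, scaled by `m` and truncated. -/
def bumpFun (m ε r : ℝ) : ℝ := min 1 (max 0 (m - 2 * (|r| / ε)))

theorem continuous_bumpFun (m ε : ℝ) : Continuous (bumpFun m ε) := by
  unfold bumpFun; fun_prop

theorem bumpFun_nonneg (m ε r : ℝ) : 0 ≤ bumpFun m ε r :=
  le_min zero_le_one (le_max_left _ _)

theorem bumpFun_le_one (m ε r : ℝ) : bumpFun m ε r ≤ 1 := min_le_left _ _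

theorem bumpFun_one_zero (ε : ℝ) : bumpFun 1 ε 0 = 1 := by simp [bumpFun]

/-- The wider bump equals `1` on the support `|r| ≤ ε / 2` of the narrower one. -/
theorem bumpFun_mul {ε : ℝ} (r : ℝ) : bumpFun 2 ε r * bumpFun 1 ε r = bumpFun 1 ε r := by
  by_cases h : 1 - 2 * (|r| / ε) ≤ 0
  · have : bumpFun 1 ε r = 0 := by unfold bumpFun; rw [max_eq_left h]; simp
    rw [this, mul_zero]
  · have : bumpFun 2 ε r = 1 := by
      unfold bumpFun
      rw [max_eq_right (by linarith), min_eq_left (by linarith)]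
    rw [this, one_mul]

theorem abs_mul_bumpFun_le {ε : ℝ} (hε : 0 < ε) (r : ℝ) : |r| * bumpFun 2 ε r ≤ ε := by
  by_cases h : |r| ≤ ε
  · calc |r| * bumpFun 2 ε r ≤ |r| * 1 := by gcongr; exact bumpFun_le_one _ _ _
      _ ≤ ε := by linarith
  · have h1 : 1 < |r| / ε := by rw [lt_div_iff₀ hε]; linarith
    have : bumpFun 2 ε r = 0 := by unfold bumpFun; rw [max_eq_left (by linarith)]; simp
    rw [this, mul_zero]
    exact hε.le

variable {X : Type u} [TopologicalSpace X] [CompactSpace X] {A : Type v} [CStarAlgebra A]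
  {B : Type w} [CStarAlgebra B]

/-- An injective C⋆-seminorm on `C(X) ⊗ A` dominates the norm of `C(X, A)` on positive elements. -/
theorem norm_tensorToFun_star_mul_self_le [T2Space X] {j : C(X, ℂ) ⊗[ℂ] A →⋆ₐ[ℂ] B}
    (hj : Function.Injective j) (t : C(X, ℂ) ⊗[ℂ] A) :
    ‖tensorToFun X A (star t * t)‖ ≤ ‖j (star t * t)‖ := by
  let := CStarAlgebra.spectralOrder A
  have := CStarAlgebra.spectralOrderedRing A
  set s := star t * t with hs
  set g := tensorToFun X A s with hg
  refine (ContinuousMap.norm_le _ (norm_nonneg _)).2 fun x₀ => ?_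
  set b := g x₀ with hb
  set M := ‖b‖ with hM
  rcases eq_or_ne M 0 with h0 | h0
  · rw [h0]; positivity
  have : Nontrivial A := ⟨b, 0, fun h => h0 (by rw [hM, h, norm_zero])⟩
  have hb0 : 0 ≤ b := by
    have : b = star (tensorToFun X A t x₀) * tensorToFun X A t x₀ := by
      rw [hb, hg, hs, map_mul, map_star]; rfl
    rw [this]
    exact star_mul_self_nonneg _
  have hbs : IsSelfAdjoint b := hb0.isSelfAdjoint
  have hMs : M ∈ spectrum ℝ b := CStarAlgebra.norm_mem_spectrum_of_nonneg hb0
  refine le_of_forall_pos_le_add fun δ hδ => ?_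
  -- Two errors share `δ`: the variation of `g` near `x₀`, and the distance of the spectral variable
  -- from `M`.
  let ε := δ / 2
  have hε : 0 < ε := half_pos hδ
  have cont : ∀ m : ℝ, Continuous fun z => bumpFun m ε (M - z) := fun m =>
    (continuous_bumpFun m ε).comp (by fun_prop)
  let e : ℝ → A := fun m => cfc (fun z => bumpFun m ε (M - z)) b
  let ψ : ℝ → C(X, ℝ) := fun m =>
    ⟨fun x => bumpFun m ε ‖g x - b‖, (continuous_bumpFun m ε).comp (by fun_prop)⟩
  -- Approximate eigenvectors of `s` for `M`: the first factor localizes where `g x` is near `b`,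
  -- the second where the spectrum of `b` is near `M`.
  let y : ℝ → C(X, ℂ) ⊗[ℂ] A := fun m => ofRealFun (ψ m) ⊗ₜ e m
  have hy : y 2 * y 1 = y 1 := by
    have h1 : ofRealFun (ψ 2) * ofRealFun (ψ 1) = ofRealFun (ψ 1) := by
      ext x
      rw [ContinuousMap.mul_apply, ofRealFun_apply, ofRealFun_apply, ← Complex.ofReal_mul]
      exact congrArg _ (bumpFun_mul _)
    have h2 : e 2 * e 1 = e 1 := by
      simp only [e]
      rw [← cfc_mul _ _ b (cont 2).continuousOn (cont 1).continuousOn]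
      exact cfc_congr fun z _ => bumpFun_mul _
    simp only [y]
    rw [Algebra.TensorProduct.tmul_mul_tmul, h1, h2]
  -- At `x₀` its image is `e 1`, whose defining function takes the value `1` at the spectral point
  -- `M`.
  have hy0 : y 1 ≠ 0 := by
    intro h
    have h1 : tensorToFun X A (y 1) x₀ = e 1 := by
      simp only [y]
      rw [tensorToFun_tmul, ofRealFun_apply]
      simp [ψ, ← hb, bumpFun_one_zero]
    have h2 : e 1 = 0 := by rw [← h1, h, map_zero]; rfl
    have h3 := norm_apply_le_norm_cfc (fun z => bumpFun 1 ε (M - z)) b hMs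
      (cont 1).continuousOn hbs
    rw [show cfc (fun z => bumpFun 1 ε (M - z)) b = 0 from h2, sub_self, bumpFun_one_zero] at h3
    norm_num at h3
  have he2 : ‖e 2‖ ≤ 1 := norm_cfc_le zero_le_one fun z _ => by
    rw [Real.norm_of_nonneg (bumpFun_nonneg _ _ _)]
    exact bumpFun_le_one _ _ _
  have hbe : ‖(b - algebraMap ℝ A M) * e 2‖ ≤ ε := by
    have h1 : (b - algebraMap ℝ A M) * e 2 =
        cfc (fun z : ℝ => (z - M) * bumpFun 2 ε (M - z)) b := by
      rw [cfc_mul (fun z : ℝ => z - M) _ b (by fun_prop) (cont 2).continuousOn,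
        cfc_sub (fun z : ℝ => z) _ b continuousOn_id continuousOn_const, cfc_id' ℝ b hbs,
        cfc_const M b hbs]
    rw [h1]
    refine norm_cfc_le hε.le fun z _ => ?_
    rw [norm_mul, Real.norm_of_nonneg (bumpFun_nonneg _ _ _), Real.norm_eq_abs, abs_sub_comm]
    exact abs_mul_bumpFun_le hε _
  let τ : C(X, ℂ) ⊗[ℂ] A := (M : ℂ) • 1
  -- The upper bound already proved moves this estimate to `C(X, A)`, where it is checked pointwise.
  have key : ‖j ((s - τ) * y 2)‖ ≤ δ := by
    refine (norm_map_le_norm_tensorToFun j _).trans ((ContinuousMap.norm_le _ hδ.le).2 fun x => ?_)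
    have h1 : tensorToFun X A ((s - τ) * y 2) x =
        (ψ 2 x : ℂ) • ((g x - b) * e 2) + (ψ 2 x : ℂ) • ((b - algebraMap ℝ A M) * e 2) := by
      have h2 : tensorToFun X A (τ) x = algebraMap ℝ A M := by
        simp only [τ]
        rw [Algebra.TensorProduct.one_def, map_smul, ContinuousMap.smul_apply, tensorToFun_tmul,
          Algebra.algebraMap_eq_smul_one, ContinuousMap.one_apply, one_smul, Complex.coe_smul]
      rw [map_mul, map_sub, ContinuousMap.mul_apply, ContinuousMap.sub_apply, h2]
      simp only [y]
      rw [tensorToFun_tmul, ofRealFun_apply, ← smul_add, ← add_mul, sub_add_sub_cancel,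
        mul_smul_comm]
    rw [h1]
    have hψ0 : 0 ≤ ψ 2 x := bumpFun_nonneg _ _ _
    have hψ1 : ψ 2 x ≤ 1 := bumpFun_le_one _ _ _
    have hψ2 : ‖g x - b‖ * ψ 2 x ≤ ε := by
      have := abs_mul_bumpFun_le hε ‖g x - b‖
      rwa [abs_of_nonneg (norm_nonneg _)] at this
    calc _ ≤ ψ 2 x * (‖g x - b‖ * ‖e 2‖) + ψ 2 x * ‖(b - algebraMap ℝ A M) * e 2‖ := by
          refine (norm_add_le _ _).trans ?_
          rw [norm_smul, norm_smul, Complex.norm_real, Real.norm_of_nonneg hψ0]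
          gcongr
          exact norm_mul_le _ _
      _ ≤ ‖g x - b‖ * ψ 2 x * 1 + 1 * ε := by
          refine add_le_add ?_ (by gcongr)
          rw [← mul_assoc, mul_comm (ψ 2 x)]
          gcongr
      _ ≤ δ := by simp only [ε] at *; linarith
  have hjy : 0 < ‖j (y 1)‖ := norm_pos_iff.2 fun h => hy0 (hj (h.trans (map_zero j).symm))
  -- `y 2 * y 1 = y 1` inserts the small factor; injectivity, in the form `j (y 1) ≠ 0`, later
  -- permits cancelling `‖j (y 1)‖`.
  have id1 : (M : ℂ) • j (y 1) =
      j s * j (y 1) - j ((s - τ) * y 2) * j (y 1) := by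
    rw [← map_mul, ← map_mul, mul_assoc (s - τ), hy, sub_mul, map_sub, sub_sub_cancel,
      smul_mul_assoc, one_mul, map_smul]
  have h2 : M * ‖j (y 1)‖ ≤ (‖j s‖ + δ) * ‖j (y 1)‖ := by
    calc M * ‖j (y 1)‖ = ‖(M : ℂ) • j (y 1)‖ := by
          rw [norm_smul, Complex.norm_real, Real.norm_of_nonneg (norm_nonneg b)]
      _ ≤ ‖j s‖ * ‖j (y 1)‖ + δ * ‖j (y 1)‖ := by
          rw [id1]
          refine (norm_sub_le _ _).trans (add_le_add (norm_mul_le _ _) ?_)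
          exact (norm_mul_le _ _).trans (by gcongr)
      _ = _ := by ring
  exact le_of_mul_le_mul_right h2 hjy

/-- The norm of `C(X, A)` induces the only C⋆-norm on `C(X) ⊗ A`. -/
theorem norm_map_eq_of_injective [T2Space X] {j : C(X, ℂ) ⊗[ℂ] A →⋆ₐ[ℂ] B}
    (hj : Function.Injective j) (t : C(X, ℂ) ⊗[ℂ] A) : ‖j t‖ = ‖tensorToFun X A t‖ := by
  refine le_antisymm (norm_map_le_norm_tensorToFun j t) ?_
  have h := norm_tensorToFun_star_mul_self_le hj t
  rw [map_mul, map_mul, map_star, map_star, CStarRing.norm_star_mul_self,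
    CStarRing.norm_star_mul_self, ← sq, ← sq] at h
  exact (sq_le_sq₀ (norm_nonneg _) (norm_nonneg _)).1 h

end Injective

/-! ### States and the minimal norm -/

section States

open scoped ComplexOrder

variable {A : Type v} [CStarAlgebra A] [PartialOrder A] [StarOrderedRing A]

/-- For real `t`, the C⋆-identity gives `‖a + i t‖² ≤ ‖a‖² + t²`, while the imaginary part of `f (a
+ i t)` is shifted by `t`. The resulting inequality is linear in `t`. -/
theorem im_eq_zero_of_norm_le_one {f : A →L[ℂ] ℂ} (hf : ‖f‖ ≤ 1) (h1 : f 1 = 1) {a : A}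
    (ha : IsSelfAdjoint a) : (f a).im = 0 := by
  have key : ∀ t : ℝ, ((f a).im + t) ^ 2 ≤ ‖a‖ ^ 2 + t ^ 2 := fun t => by
    let z : A := a + (t * Complex.I : ℂ) • 1
    have hz : star z * z = a * a + ((t : ℂ) ^ 2) • 1 := by
      have hI : (t * Complex.I) * (t * Complex.I) = -(t : ℂ) ^ 2 := by
        linear_combination (t : ℂ) ^ 2 * Complex.I_mul_I
      simp only [z, star_add, star_smul, star_one, ha.star_eq, Complex.star_def, map_mul,
        Complex.conj_ofReal, Complex.conj_I, mul_neg, neg_smul, add_mul, mul_add, neg_mul,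
        smul_mul_assoc, mul_smul_comm, one_mul, mul_one]
      rw [smul_add, smul_neg, smul_smul, hI]
      module
    have hz2 : ‖z‖ ^ 2 ≤ ‖a‖ ^ 2 + t ^ 2 := by
      rw [sq ‖z‖, ← CStarRing.norm_star_mul_self, hz]
      refine (norm_add_le _ _).trans (add_le_add ((norm_mul_le _ _).trans (sq ‖a‖).ge) ?_)
      rw [norm_smul]
      have h2 : ‖(1 : A)‖ ≤ 1 := by
        rcases subsingleton_or_nontrivial A with h | h
        · simp [Subsingleton.elim (1 : A) 0]
        · exact CStarRing.norm_one.le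
      refine (mul_le_of_le_one_right (norm_nonneg _) h2).trans_eq ?_
      rw [norm_pow, Complex.norm_real, Real.norm_eq_abs, sq_abs]
    have hfz : f z = f a + t * Complex.I := by simp [z, h1]
    calc ((f a).im + t) ^ 2 = (f z).im ^ 2 := by rw [hfz]; simp
      _ ≤ ‖f z‖ ^ 2 := by
        rw [← sq_abs]; gcongr; exact Complex.abs_im_le_norm _
      _ ≤ ‖z‖ ^ 2 := by
        gcongr
        exact (f.le_of_opNorm_le hf z).trans (one_mul _).le
      _ ≤ _ := hz2
  by_contra h
  -- This `t` makes the cross term `‖a‖² + 1`, exceeding the allowed `‖a‖²`.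
  have h2 := key ((‖a‖ ^ 2 + 1) / (2 * (f a).im))
  have h3 : 2 * (f a).im * ((‖a‖ ^ 2 + 1) / (2 * (f a).im)) = ‖a‖ ^ 2 + 1 := by field_simp
  nlinarith [sq_nonneg (f a).im]

/-- A functional of norm at most one which maps `1` to `1` is positive. -/
theorem nonneg_of_norm_le_one {f : A →L[ℂ] ℂ} (hf : ‖f‖ ≤ 1) (h1 : f 1 = 1) {a : A}
    (ha : 0 ≤ a) : 0 ≤ f a := by
  have him := im_eq_zero_of_norm_le_one hf h1 ha.isSelfAdjoint
  -- Applying `f` puts `f a` in the disc of radius `‖a‖` about `‖a‖`, so its real part is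
  -- nonnegative.
  have h2 : ‖algebraMap ℝ A ‖a‖ - a‖ ≤ ‖a‖ := by
    refine (CStarAlgebra.norm_le_iff_le_algebraMap _ (norm_nonneg a)
      (sub_nonneg.2 ha.isSelfAdjoint.le_algebraMap_norm_self)).2 ?_
    exact sub_le_self _ ha
  have h3 : f (algebraMap ℝ A ‖a‖ - a) = (‖a‖ : ℂ) - f a := by
    rw [map_sub, Algebra.algebraMap_eq_smul_one, ← Complex.coe_smul, map_smul, h1]
    simp
  have h4 : ‖(‖a‖ : ℂ) - f a‖ ≤ ‖a‖ := by
    rw [← h3]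
    exact ((f.le_of_opNorm_le hf _).trans (one_mul _).le).trans h2
  have h5 := (Complex.abs_re_le_norm _).trans h4
  rw [Complex.sub_re, Complex.ofReal_re] at h5
  rw [Complex.le_def]
  exact ⟨by simp only [Complex.zero_re]; linarith [(abs_le.1 h5).2], by simp [him]⟩

/-- For every positive element there is a state which attains its norm there. -/
theorem exists_state [Nontrivial A] {b : A} (hb : 0 ≤ b) :
    ∃ f : A →ₚ[ℂ] ℂ, f 1 = 1 ∧ f b = ‖b‖ := by
  -- A norming functional of `b + 1` must then attain its bounds `‖b‖` at `b` and `1` at `1`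
  -- simultaneously.
  have hn : ‖b + 1‖ = ‖b‖ + 1 := by
    refine le_antisymm ((norm_add_le _ _).trans_eq (by rw [CStarRing.norm_one])) ?_
    have h1 : ‖b‖ + 1 ∈ spectrum ℝ (algebraMap ℝ A 1 + b) := by
      rw [spectrum.add_mem_add_iff]
      exact CStarAlgebra.norm_mem_spectrum_of_nonneg hb
    have h2 := spectrum.norm_le_norm_of_mem h1
    rw [map_one, add_comm 1 b] at h2
    rwa [Real.norm_of_nonneg (by positivity)] at h2
  have hne : b + 1 ≠ 0 := fun h => by
    rw [h, norm_zero] at hn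
    linarith [norm_nonneg b]
  obtain ⟨f, hf, hfb⟩ := exists_dual_vector ℂ (b + 1) (norm_ne_zero_iff.2 hne)
  have hle : ∀ a, ‖f a‖ ≤ ‖a‖ := fun a => (f.le_of_opNorm_le hf.le a).trans (one_mul _).le
  have hre : (f b).re + (f 1).re = ‖b‖ + 1 := by
    have := congrArg Complex.re hfb
    rw [map_add, Complex.add_re] at this
    rw [this, hn]
    simp
  have hb1 : ‖f b‖ ≤ ‖b‖ := hle b
  have h11 : ‖f 1‖ ≤ 1 := (hle 1).trans CStarRing.norm_one.le
  have eqre : ∀ {z : ℂ} {r : ℝ}, ‖z‖ ≤ r → r ≤ z.re → z = r := fun {z r} h h' => by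
    have hr : z.re = ‖z‖ := le_antisymm (Complex.re_le_norm z) (h.trans h')
    have hz := (Complex.re_eq_norm.1 hr)
    have h2 : z.re = r := le_antisymm ((Complex.re_le_norm z).trans h) h'
    refine Complex.ext (by simpa using h2) ?_
    simpa using (Complex.le_def.1 hz).2.symm
  have h1 : f 1 = 1 := by
    have := eqre h11 (by linarith [Complex.re_le_norm (f b)])
    simpa using this
  have hb' : f b = ‖b‖ := eqre hb1 (by linarith [Complex.re_le_norm (f 1)])
  exact ⟨PositiveLinearMap.mk₀ f.toLinearMap fun a ha => nonneg_of_norm_le_one hf.le h1 ha,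
    h1, hb'⟩

/-- For every element there is a representation on a Hilbert space and a vector on which its norm
is attained. -/
theorem exists_representation (a : A) : ∃ (K : Type v) (_ : NormedAddCommGroup K)
    (_ : InnerProductSpace ℂ K) (_ : CompleteSpace K) (ρ : A →⋆ₐ[ℂ] (K →L[ℂ] K)) (ξ : K),
    ‖ξ‖ ≤ 1 ∧ ‖ρ a ξ‖ = ‖a‖ := by
  rcases subsingleton_or_nontrivial A with h | h
  -- The zero algebra has no state; the zero functional and vector do, since only `‖ξ‖ ≤ 1` is
  -- required.
  · obtain ⟨f⟩ : Nonempty (A →ₚ[ℂ] ℂ) := ⟨0⟩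
    exact ⟨f.GNS, inferInstance, inferInstance, inferInstance, f.gnsStarAlgHom, 0, by simp,
      by simp [Subsingleton.elim a 0]⟩
  -- With `f (a⋆a) = ‖a‖²`, the class of `1` in the GNS space is sent to a vector of norm `‖a‖`.
  · obtain ⟨f, h1, hb⟩ := exists_state (star_mul_self_nonneg a)
    have hn : ∀ c : A, ‖((f.toPreGNS c : f.PreGNS) : f.GNS)‖ ^ 2 = f (star c * c) := fun c => by
      rw [UniformSpace.Completion.norm_coe]
      exact f.preGNS_norm_sq (f.toPreGNS c)
    refine ⟨f.GNS, inferInstance, inferInstance, inferInstance, f.gnsStarAlgHom,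
      ((f.toPreGNS 1 : f.PreGNS) : f.GNS), ?_, ?_⟩
    · have := hn 1
      rw [star_one, mul_one, h1] at this
      have h2 : ‖((f.toPreGNS 1 : f.PreGNS) : f.GNS)‖ ^ 2 = 1 := by exact_mod_cast this
      nlinarith [norm_nonneg ((f.toPreGNS 1 : f.PreGNS) : f.GNS)]
    · have e : f.gnsStarAlgHom a ((f.toPreGNS 1 : f.PreGNS) : f.GNS) =
          ((f.toPreGNS a : f.PreGNS) : f.GNS) := by
        show f.gnsNonUnitalStarAlgHom a _ = _
        rw [PositiveLinearMap.gnsNonUnitalStarAlgHom_apply_coe]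
        simp
      have h2 := hn a
      rw [hb, CStarRing.norm_star_mul_self, ← sq] at h2
      have h3 : ‖((f.toPreGNS a : f.PreGNS) : f.GNS)‖ ^ 2 = ‖a‖ ^ 2 := by exact_mod_cast h2
      rw [e]
      exact (sq_eq_sq₀ (norm_nonneg _) (norm_nonneg _)).1 h3

end States

/-! ### Tensor products of representations and the spatial norm -/

section MinimalNorm

section Completion

open UniformSpace

namespace ContinuousLinearMap

variable {E : Type*} [NormedAddCommGroup E] [NormedSpace ℂ E]

theorem completion_add (S T : E →L[ℂ] E) :
    (S + T).completion = S.completion + T.completion := by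
  ext x
  refine Completion.induction_on x (isClosed_eq (S + T).completion.continuous
    (S.completion + T.completion).continuous) fun x => ?_
  rw [add_apply, completion_apply_coe, completion_apply_coe, completion_apply_coe, add_apply,
    Completion.coe_add]

theorem completion_smul (c : ℂ) (T : E →L[ℂ] E) : (c • T).completion = c • T.completion := by
  ext x
  refine Completion.induction_on x (isClosed_eq (c • T).completion.continuous
    (c • T.completion).continuous) fun x => ?_
  rw [smul_apply, completion_apply_coe, completion_apply_coe, smul_apply, Completion.coe_smul]

theorem completion_one : (1 : E →L[ℂ] E).completion = 1 := by
  ext x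
  refine Completion.induction_on x (isClosed_eq (1 : E →L[ℂ] E).completion.continuous
    (1 : Completion E →L[ℂ] Completion E).continuous) fun x => ?_
  rw [completion_apply_coe]
  rfl

theorem completion_mul (S T : E →L[ℂ] E) :
    (S * T).completion = S.completion * T.completion := by
  ext x
  refine Completion.induction_on x (isClosed_eq (S * T).completion.continuous
    (S.completion * T.completion).continuous) fun x => ?_
  show (S * T).completion (x : Completion E) = S.completion (T.completion x)
  rw [completion_apply_coe, completion_apply_coe, completion_apply_coe]
  rfl

/-- Bounded operators on the completion form a C⋆-algebra; adjointness extends to it by density. -/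
theorem inner_completion_eq {E : Type*} [NormedAddCommGroup E] [InnerProductSpace ℂ E]
    {S T : E →L[ℂ] E} (h : ∀ x y, inner ℂ (S x) y = inner ℂ x (T y)) (x y : Completion E) :
    inner ℂ (S.completion x) y = inner ℂ x (T.completion y) := by
  refine Completion.induction_on₂ x y (isClosed_eq
    ((S.completion.continuous.comp continuous_fst).inner continuous_snd)
    (continuous_fst.inner (T.completion.continuous.comp continuous_snd))) fun x y => ?_
  rw [completion_apply_coe, completion_apply_coe, Completion.inner_coe, Completion.inner_coe, h]

end ContinuousLinearMap

end Completion

section TensorRep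

variable {A : Type*} {B : Type*} [CStarAlgebra A] [CStarAlgebra B] {H K : Type*}
  [NormedAddCommGroup H] [InnerProductSpace ℂ H] [CompleteSpace H]
  [NormedAddCommGroup K] [InnerProductSpace ℂ K] [CompleteSpace K]
  (π : A →⋆ₐ[ℂ] (H →L[ℂ] H)) (ρ : B →⋆ₐ[ℂ] (K →L[ℂ] K))

theorem tensorRep_tmul (a : A) (b : B) :
    tensorRep π ρ (a ⊗ₜ b) = TensorProduct.mapL (π a) (ρ b) := rfl

theorem tensorRep_one : tensorRep π ρ 1 = 1 := by
  rw [Algebra.TensorProduct.one_def, tensorRep_tmul, map_one, map_one]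
  exact TensorProduct.mapL_id_id

theorem tensorRep_mul (s t : A ⊗[ℂ] B) :
    tensorRep π ρ (s * t) = tensorRep π ρ s * tensorRep π ρ t := by
  induction s using TensorProduct.induction_on with
  | zero => simp
  | add s s' hs hs' => rw [add_mul, map_add, map_add, hs, hs', add_mul]
  | tmul a b =>
    induction t using TensorProduct.induction_on with
    | zero => simp
    | add t t' ht ht' => rw [mul_add, map_add, map_add, ht, ht', mul_add]
    | tmul a' b' =>
      rw [Algebra.TensorProduct.tmul_mul_tmul, tensorRep_tmul, tensorRep_tmul, tensorRep_tmul,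
        map_mul, map_mul, TensorProduct.mapL_mul]

theorem inner_tensorRep_star (t : A ⊗[ℂ] B) (x y : H ⊗[ℂ] K) :
    inner ℂ (tensorRep π ρ (star t) x) y = inner ℂ x (tensorRep π ρ t y) := by
  induction t using TensorProduct.induction_on with
  | zero => simp
  | add s t hs ht =>
    rw [star_add, map_add, map_add, add_apply, add_apply,
      inner_add_left, inner_add_right, hs, ht]
  | tmul a b =>
    rw [TensorProduct.star_tmul, tensorRep_tmul, tensorRep_tmul]
    induction x using TensorProduct.induction_on with
    | zero => simp
    | add x x' hx hx' => rw [map_add, inner_add_left, inner_add_left, hx, hx']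
    | tmul h k =>
      induction y using TensorProduct.induction_on with
      | zero => simp
      | add y y' hy hy' => rw [map_add, inner_add_right, inner_add_right, hy, hy']
      | tmul h' k' =>
        rw [TensorProduct.mapL_tmul, TensorProduct.mapL_tmul, TensorProduct.inner_tmul,
          TensorProduct.inner_tmul, map_star, map_star, ContinuousLinearMap.star_eq_adjoint,
          ContinuousLinearMap.star_eq_adjoint, ContinuousLinearMap.adjoint_inner_left,
          ContinuousLinearMap.adjoint_inner_left]

open UniformSpace ContinuousLinearMap in
/-- The tensor product of two representations, on the Hilbert space tensor product. -/
def tensorStarRep : A ⊗[ℂ] B →⋆ₐ[ℂ] (Completion (H ⊗[ℂ] K) →L[ℂ] Completion (H ⊗[ℂ] K)) where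
  toAlgHom := AlgHom.ofLinearMap
    { toFun := fun t => (tensorRep π ρ t).completion
      map_add' := fun s t => by
        rw [map_add, completion_add]
      map_smul' := fun c t => by
        rw [map_smul, completion_smul, RingHom.id_apply] }
    (by
      show (tensorRep π ρ 1).completion = 1
      rw [tensorRep_one, completion_one])
    (fun s t => by
      show (tensorRep π ρ (s * t)).completion = _
      rw [tensorRep_mul, completion_mul]
      rfl)
  map_star' t := by
    refine (ContinuousLinearMap.eq_adjoint_iff _ _).2 fun x y => ?_
    show inner ℂ ((tensorRep π ρ (star t)).completion x) y =
      inner ℂ x ((tensorRep π ρ t).completion y)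
    refine inner_completion_eq (fun x y => inner_tensorRep_star π ρ t x y) x y

/-- The algebraic tensor product embeds isometrically in its completion, where the operator extends.
-/
theorem norm_tensorRep_le (t : A ⊗[ℂ] B) : ‖tensorRep π ρ t‖ ≤ ‖tensorStarRep π ρ t‖ := by
  refine ContinuousLinearMap.opNorm_le_bound _ (ContinuousLinearMap.opNorm_nonneg _) fun x => ?_
  have h : tensorStarRep π ρ t (x : UniformSpace.Completion (H ⊗[ℂ] K)) =
      (tensorRep π ρ t x : H ⊗[ℂ] K) := by
    show (tensorRep π ρ t).completion x = _
    rw [ContinuousLinearMap.completion_apply_coe]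
  have h2 := (tensorStarRep π ρ t).le_opNorm (x : UniformSpace.Completion (H ⊗[ℂ] K))
  rwa [h, UniformSpace.Completion.norm_coe, UniformSpace.Completion.norm_coe] at h2

end TensorRep

variable {X : Type u} [TopologicalSpace X] [CompactSpace X] [T2Space X] {A : Type v}
  [CStarAlgebra A]

/-- Evaluation at a point as a representation on a one-dimensional Hilbert space. -/
def evalRep (x : X) : C(X, ℂ) →⋆ₐ[ℂ]
    (EuclideanSpace ℂ PUnit.{u + 1} →L[ℂ] EuclideanSpace ℂ PUnit.{u + 1}) where
  toFun f := f x • ContinuousLinearMap.id ℂ _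
  map_one' := by simp; rfl
  map_mul' f g := by
    ext; simp [mul_assoc, mul_left_comm]
  map_zero' := by ext; simp
  map_add' f g := by ext; simp [add_mul]
  commutes' c := by
    ext; simp
  map_star' f := by
    refine (ContinuousLinearMap.eq_adjoint_iff _ _).2 fun v w => ?_
    simp [inner_smul_left, inner_smul_right]

/-- The first factor acts by scalars `f x`, which pass to the second, so only the value at `x` is
seen. -/
theorem tensorRep_evalRep {K : Type*} [NormedAddCommGroup K] [InnerProductSpace ℂ K]
    [CompleteSpace K] (ρ : A →⋆ₐ[ℂ] (K →L[ℂ] K)) (x : X) (t : C(X, ℂ) ⊗[ℂ] A)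
    (h : EuclideanSpace ℂ PUnit.{u + 1}) (k : K) :
    tensorRep (evalRep x) ρ t (h ⊗ₜ k) = h ⊗ₜ ρ (tensorToFun X A t x) k := by
  induction t using TensorProduct.induction_on with
  | zero => simp
  | add s t hs ht =>
    rw [map_add, map_add, ContinuousMap.add_apply, map_add, add_apply,
      add_apply, TensorProduct.tmul_add, hs, ht]
  | tmul f a =>
    rw [tensorRep_tmul, TensorProduct.mapL_tmul, tensorToFun_tmul, map_smul,
      smul_apply, TensorProduct.tmul_smul]
    show (f x • h) ⊗ₜ[ℂ] _ = _
    rw [TensorProduct.smul_tmul']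

theorem norm_representation_le {L : Type*} [NormedAddCommGroup L] [InnerProductSpace ℂ L]
    [CompleteSpace L] (σ : C(X, ℂ) ⊗[ℂ] A →⋆ₐ[ℂ] (L →L[ℂ] L)) (t : C(X, ℂ) ⊗[ℂ] A) :
    ‖σ t‖ ≤ ‖tensorToFun X A t‖ :=
  norm_map_le_norm_tensorToFun (B := L →L[ℂ] L) σ t

/-- The norm of `C(X, A)` induces the minimal C⋆-norm on `C(X) ⊗ A`. -/
theorem enorm_tensorToFun (t : C(X, ℂ) ⊗[ℂ] A) : ‖tensorToFun X A t‖ₑ = minTensorNorm t := by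
  let := CStarAlgebra.spectralOrder A
  have := CStarAlgebra.spectralOrderedRing A
  refine le_antisymm ?_ ?_
  · have hle : ∀ x, ‖tensorToFun X A t x‖ₑ ≤ minTensorNorm t := fun x => by
      obtain ⟨K, _, _, _, ρ, ξ, hξ, hρ⟩ := exists_representation (tensorToFun X A t x)
      let h : EuclideanSpace ℂ PUnit.{u + 1} := EuclideanSpace.single PUnit.unit 1
      have hh : ‖h‖ = 1 := by simp [h]
      have h1 : ‖tensorToFun X A t x‖ₑ ≤ ‖tensorRep (evalRep x) ρ t‖ₑ := by
        rw [enorm_le_iff_norm_le]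
        have h2 := (tensorRep (evalRep x) ρ t).le_opNorm (h ⊗ₜ ξ)
        rw [tensorRep_evalRep, TensorProduct.norm_tmul, TensorProduct.norm_tmul, hρ, hh, one_mul,
          one_mul] at h2
        exact h2.trans (mul_le_of_le_one_right (norm_nonneg _) hξ)
      refine h1.trans ?_
      unfold minTensorNorm
      exact le_iSup_of_le _ <| le_iSup_of_le _ <| le_iSup_of_le _ <| le_iSup_of_le inferInstance <|
        le_iSup_of_le K <| le_iSup_of_le _ <| le_iSup_of_le _ <| le_iSup_of_le inferInstance <|
        le_iSup_of_le (evalRep x) <| le_iSup_of_le ρ le_rfl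
    -- A supremum in `ℝ≥0∞` may be infinite a priori; only a finite one can be compared with the
    -- real supremum norm.
    by_cases hM : minTensorNorm t = ⊤
    · rw [hM]; exact le_top
    · rw [← ofReal_norm, ← ENNReal.ofReal_toReal hM]
      refine ENNReal.ofReal_le_ofReal ((ContinuousMap.norm_le _ ENNReal.toReal_nonneg).2 fun x => ?_)
      rw [← toReal_enorm]
      exact ENNReal.toReal_mono hM (hle x)
  · unfold minTensorNorm
    refine iSup_le fun H => iSup_le fun _ => iSup_le fun _ => iSup_le fun _ => iSup_le fun K =>
      iSup_le fun _ => iSup_le fun _ => iSup_le fun _ => iSup_le fun π => iSup_le fun ρ => ?_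
    rw [enorm_le_iff_norm_le]
    exact (norm_tensorRep_le π ρ t).trans (norm_representation_le (tensorStarRep π ρ) t)

end MinimalNorm

end

theorem mainTheorem11 (X : Type u) [TopologicalSpace X] [CompactSpace X] [T2Space X]
    (A : Type v) [CStarAlgebra A] [PartialOrder A] [StarOrderedRing A] :
    (∃ (hfin : ∀ E : FGPBundle A X, Module.Finite C(X, A)ᵐᵒᵖ E.toHilbertBundle.sections)
      (hproj : ∀ E : FGPBundle A X, Module.Projective C(X, A)ᵐᵒᵖ E.toHilbertBundle.sections)
      (s : BundleK A X ≃+ KZero C(X, A)),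
        ∀ E : FGPBundle A X,
          s E.toK = FGPModule.toK ⟨E.toHilbertBundle.sections, hfin E, hproj E⟩) ∧
    ∃ ι : C(X, ℂ) ⊗[ℂ] A →⋆ₐ[ℂ] C(X, A),
      (∀ (f : C(X, ℂ)) (a : A) (x : X), ι (f ⊗ₜ a) x = f x • a) ∧
      Function.Injective ι ∧ DenseRange ι ∧
      (∀ t, ‖ι t‖ₑ = minTensorNorm t) ∧
      ∀ (B : Type w) [CStarAlgebra B] (j : C(X, ℂ) ⊗[ℂ] A →⋆ₐ[ℂ] B), Function.Injective j →
        ∀ t, ‖j t‖ = ‖ι t‖ := by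
  obtain ⟨s, hs⟩ := exists_bundleK_equiv A X
  exact ⟨⟨fun E => E.finite_sections, fun E => E.projective_sections, s, hs⟩,
    tensorToFun X A, tensorToFun_tmul, injective_tensorToFun X A, denseRange_tensorToFun X A,
    enorm_tensorToFun, fun B _ j hj t => norm_map_eq_of_injective hj t⟩
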